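/- **Setting.** Fix parameters $X_1,\dots,X_k$ and let $\mathbb X=\{X_1,\overline{X_1},\dots,X_k,\overline{X_k}\}$. Parametric PCF has simple types $A::=\mathrm{Bool}\mid\mathbf N\mid A\to A$ and terms $M::=0\mid \mathrm{SUCC}\,M\mid \mathrm{PRED}\,M\mid \mathrm{ifz}(M,M,M)\mid x\mid\lambda x.M\mid MM\mid \mathrm YM\mid M\oplus_{X_i}M$ (modulo $\alpha$), with the usual typing rules, where $0,1$ are also Booleans and $\Gamma\vdash M:\mathrm{Bool}$ implies $\Gamma\vdash M:\mathbf N$ (cast). Put $\llbracket\mathrm{Bool}\rrbracket=\{0,1\}$, $\llbracket\mathbf N\rrbracket=\mathbb N$, $\llbracket A\to B\rrbracket={!\llbracket A\rrbracket}\times\llbracket B\rrbracket$, where $!\Sigma$ is the set of finite multisets over $\Sigma$. A typing derivation $\Pi$ of $\Gamma\vdash M:A$ has a parametric weighted relational interpretation: for $a\in\llbracket A\rrbracket$ and $\gamma(x)\in{!\llbracket\Gamma(x)\rrbracket}$, a formal power series $\llbracket\Pi\rrbracket_{\gamma,a}$ over $\mathbb N^\infty$ in the variables $\mathbb X$. It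 is obtained from the weighted relational model of PCF with coefficients in $\mathbb N^\infty\{\{\mathbb X\}\}$, the choice $M\oplus_{X_i}N$ being interpreted by $X_i\cdot\llbracket M\rrbracket+\overline{X_i}\cdot\llbracket N\rrbracket$ and $\mathrm Y$ by a least fixed point. **Minimal monomials.** For a set $S$ of monomials over $\mathbb X$, seen as points of $\mathbb N^{2k}$, $S_{\min}$ is the set of those vertices (extreme points) of the convex hull of $S$ that are minimal among these vertices for the pointwise order. For a polynomial $s$ over the tropical semiring $\mathbb T=[0,\infty]$, $s_{\min}=\sum_{\mu\in\mathrm{supp}(s)_{\min}}\mu$, and $\mathbf{VN}(s_1,\dots,s_p)=(\prod_i s_i)_{\min}$. **The system $\mathbf P_{\mathrm{trop}}$.** Types are $a::=n\in\mathbb N\mid[a,\dots,a]\multimap a$, with finite multisets on the left; contexts map variables to finite multisets of types, almost all empty, and are added variable-wise. $M:\langle\gamma_j\vdash^{s_j}a_j\rangle_j$ is a finite family of typings of $M$, where the $s_j$ are tropical polynomials over $\mathbb X$. It is a judgement if the pairs $(\gamma_j,a_j)$ are pairwise distinct and the $s_j$ minimal. $\mathrm{merge}$ adds the polynomials of equal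 pairs $(\gamma,a)$ and then minimizes. The rules, whose conclusions are judgements, are: - $(\emptyset)$ $M:\langle\rangle$; (id) $x:\langle x:[a_i]\vdash^1a_i\rangle_i$; (n) $\mathsf n:\langle\vdash^1n\rangle$; - (S), (P), ($\lambda$): from $M:\langle\gamma_i\vdash^{s_i}n_i\rangle_i$ infer $\mathrm{SUCC}\,M:\langle\gamma_i\vdash^{s_i}n_i+1\rangle_i$ and $\mathrm{PRED}\,M:\langle\gamma_i\vdash^{s_i}n_i\dot-1\rangle_i$; from $M:\langle\gamma_i,x:m_i\vdash^{s_i}b_i\rangle_i$ infer $\lambda x.M:\langle\gamma_i\vdash^{s_i}m_i\multimap b_i\rangle_i$; - ($\oplus$) from $M:\langle\gamma_i\vdash^{s_i}a_i\rangle_i$ and $N:\langle\delta_j\vdash^{t_j}b_j\rangle_j$ infer $M\oplus_XN:\mathrm{merge}\langle\gamma_i\vdash^{s_iX}a_i\mid\delta_j\vdash^{t_j\overline X}b_j\rangle_{i,j}$; - (ifz) from judgements for $M$ (all types numbers), $N$ and $P$, infer for $\mathrm{ifz}(M,N,P)$ the merge of a finite family of typings $\gamma+\delta\vdash^{\mathbf{VN}(s,t)}a$,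 each obtained from a typing $\gamma\vdash^s0$ of $M$ and a typing $\delta\vdash^ta$ of $N$, or from a typing $\gamma\vdash^sn+1$ of $M$ and a typing $\delta\vdash^ta$ of $P$; - ($@$) from judgements for $M$ and $N$, infer for $MN$ the merge of a finite family of typings $\gamma+\sum_j\delta_j\vdash^{\mathbf{VN}(s,s'_1,\dots,s'_p)}b$, each obtained from a typing $\gamma\vdash^s[a_1,\dots,a_p]\multimap b$ of $M$ and typings $\delta_j\vdash^{s'_j}a_j$ $(1\le j\le p)$ of $N$; a typing may be used several times, and every typing of the two judgements is used; - ($\mathrm Y$) as ($@$), with $\mathrm YM$ in place of both $N$ and $MN$. **Refinement.** $(\gamma,a)$ refines $(\Gamma,A)$ if $a\in\llbracket A\rrbracket$ (identifying $m\multimap b$ with $(m,b)$), $\gamma(x)\in{!\llbracket\Gamma(x)\rrbracket}$ for the $x$ declared in $\Gamma$, and $\gamma(x)=[\,]$ otherwise. A $\mathbf P_{\mathrm{trop}}$-derivation $\pi$ for $M$, all of whose typings refine $(\Gamma,A)$, refines a typing derivation $\Pi$ of $\Gamma\vdash M:A$ if its rules match those of $\Pi$, where $(\emptyset)$ refines any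 $\Pi$; casts in $\Pi$ are skipped; and if $\Pi$ ends with the fixpoint rule, for $\mathrm YM$, on $\Pi'$, and $\pi$ ends with a cluster of $h$ rules $(\mathrm Y)$, then the derivation for $M^hy$ ($y$ fresh) obtained from $\pi$ by replacing these with rules $(@)$ refines the derivation of $\Gamma,y:A\vdash M^hy:A$ built from $h$ copies of $\Pi'$. **Theorem (completeness of $\mathbf P_{\mathrm{trop}}$ with respect to the minimal WRS).** Let $\Pi$ be a typing derivation of $\Gamma\vdash M:A$ and let $(\gamma,a)$ refine $(\Gamma,A)$. For every $\mu\in\mathrm{supp}(\llbracket\Pi\rrbracket_{\gamma,a})_{\min}$ there is a $\mathbf P_{\mathrm{trop}}$-derivation $\pi$ of $M:\langle\gamma\vdash^sa\rangle$, for some $s$, that refines $\Pi$ and satisfies $\mu\in\mathrm{supp}(s)$. Moreover, if $\Pi$ is a typing derivation of $\vdash M:\mathbf N$, then for all $n\in\mathbb N$ and $q\in[0,\infty]^{\mathbb X}$, with $\mu\cdot q=\sum_{V\in\mathbb X}\mu(V)q_V$ and $0\cdot\infty=0$, $$\inf_{\mu\in\mathrm{supp}(\llbracket\Pi\rrbracket_{n})}\mu\cdot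 q=\inf\{\mu\cdot q\mid \mu\in\mathrm{supp}(s)\text{ for some derivation of }M:\langle\vdash^sn\rangle\text{ that refines }\Pi\},$$ where the left-hand side is the tropicalization $\mathsf t^!\llbracket\Pi\rrbracket_n(q)$. -/

import Mathlib

open scoped ENNReal

noncomputable section

namespace PCFX

/-! ### Terms, simple types and typing derivations of parametric PCF -/

/-- Simple types. -/
inductive Ty : Type
  | bool : Ty
  | nat : Ty
  | arr : Ty → Ty → Ty

/-- Terms with `k` parameters, up to renaming of bound variables (de Bruijn indices).
`choice i M N` is the choice between `M` and `N` controlled by the parameter `X_i`. -/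
inductive Term (k : ℕ) : Type
  | zero : Term k
  | succ : Term k → Term k
  | pred : Term k → Term k
  | ifz : Term k → Term k → Term k → Term k
  | var : ℕ → Term k
  | lam : Term k → Term k
  | app : Term k → Term k → Term k
  | fix : Term k → Term k
  | choice : Fin k → Term k → Term k → Term k

/-- The numeral `n`, that is `SUCC^n 0`. -/
def Term.numeral {k : ℕ} : ℕ → Term k
  | 0 => .zero
  | n + 1 => .succ (Term.numeral n)

/-- The iterated application `M^(n) N = M (M (... (M N)))`. -/
def Term.iter {k : ℕ} (M : Term k) : ℕ → Term k → Term k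
  | 0, N => N
  | n + 1, N => .app M (Term.iter M n N)

/-- Typing derivations. The context is the list of the types of the variables `0, 1, 2, …`;
a variable whose index is not below the length of the list is not declared. -/
inductive Deriv {k : ℕ} : List Ty → Term k → Ty → Type
  | zeroNat {Γ} : Deriv Γ .zero .nat
  | zeroBool {Γ} : Deriv Γ .zero .bool
  | oneBool {Γ} : Deriv Γ (.succ .zero) .bool
  | succ {Γ M} : Deriv Γ M .nat → Deriv Γ (.succ M) .nat
  | pred {Γ M} : Deriv Γ M .nat → Deriv Γ (.pred M) .nat
  | cast {Γ M} : Deriv Γ M .bool → Deriv Γ M .nat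
  | var {Γ A} (x : ℕ) (h : Γ[x]? = some A) : Deriv Γ (.var x) A
  | lam {Γ M A B} : Deriv (A :: Γ) M B → Deriv Γ (.lam M) (.arr A B)
  | app {Γ M N A B} : Deriv Γ M (.arr A B) → Deriv Γ N A → Deriv Γ (.app M N) B
  | ifz {Γ M N P A} : Deriv Γ M .nat → Deriv Γ N A → Deriv Γ P A → Deriv Γ (.ifz M N P) A
  | choice {Γ M N A} (i : Fin k) : Deriv Γ M A → Deriv Γ N A → Deriv Γ (.choice i M N) A
  | fix {Γ M A} : Deriv Γ M (.arr A A) → Deriv Γ (.fix M) A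

theorem lookup_cons {Γ Δ : List Ty} (h : ∀ (x : ℕ) (A : Ty), Γ[x]? = some A → Δ[x]? = some A)
    (B : Ty) : ∀ (x : ℕ) (A : Ty), (B :: Γ)[x]? = some A → (B :: Δ)[x]? = some A := by
  intro x A hx
  cases x with
  | zero => simpa using hx
  | succ x => simpa using h x A (by simpa using hx)

theorem lookup_append {Γ : List Ty} (Δ : List Ty) :
    ∀ (x : ℕ) (A : Ty), Γ[x]? = some A → (Γ ++ Δ)[x]? = some A := by
  intro x A hx
  obtain ⟨h, _⟩ := List.getElem?_eq_some_iff.mp hx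
  rw [List.getElem?_append_left h]
  exact hx

/-- Weakening of a typing derivation: the same derivation, in a context with more declarations. -/
def Deriv.weaken {k : ℕ} {Γ : List Ty} {M : Term k} {A : Ty} (d : Deriv Γ M A) {Δ : List Ty}
    (h : ∀ (x : ℕ) (A : Ty), Γ[x]? = some A → Δ[x]? = some A) : Deriv Δ M A :=
  match d with
  | .zeroNat => .zeroNat
  | .zeroBool => .zeroBool
  | .oneBool => .oneBool
  | .succ d => .succ (d.weaken h)
  | .pred d => .pred (d.weaken h)
  | .cast d => .cast (d.weaken h)
  | .var x hx => .var x (h x _ hx)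
  | .lam d => .lam (d.weaken (lookup_cons h _))
  | .app d e => .app (d.weaken h) (e.weaken h)
  | .ifz d e f => .ifz (d.weaken h) (e.weaken h) (f.weaken h)
  | .choice i d e => .choice i (d.weaken h) (e.weaken h)
  | .fix d => .fix (d.weaken h)

/-- From a derivation of `Γ ⊢ M : A → A`, the derivation of `Γ, y : A ⊢ M^(n) y : A`, with `y` the
first variable that `Γ` does not declare. It is declared at the outer end of the context, so that
`M` is literally the same term in `Γ` and in `Γ, y : A`. -/
def Deriv.unfold {k : ℕ} {Γ : List Ty} {M : Term k} {A : Ty} (d : Deriv Γ M (.arr A A)) :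
    (n : ℕ) → Deriv (Γ ++ [A]) (M.iter n (.var Γ.length)) A
  | 0 => .var Γ.length (by simp)
  | n + 1 => .app (d.weaken (lookup_append [A])) (d.unfold n)

/-! ### Intersection types `a ::= n | [a, …, a] ⊸ a`, with finite multisets on the left -/

/-- Intersection types with lists in place of multisets. -/
inductive RawTy : Type
  | nat : ℕ → RawTy
  | arr : List RawTy → RawTy → RawTy

/-- One permutation of a list somewhere inside a raw type. -/
inductive RawTy.Step : RawTy → RawTy → Prop
  | perm {l l' : List RawTy} (b : RawTy) : l.Perm l' → Step (.arr l b) (.arr l' b)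
  | left {a a' : RawTy} (l l' : List RawTy) (b : RawTy) : Step a a' →
      Step (.arr (l ++ a :: l') b) (.arr (l ++ a' :: l') b)
  | right {b b' : RawTy} (l : List RawTy) : Step b b' → Step (.arr l b) (.arr l b')

/-- Intersection types: raw types up to permutations of the lists in them. -/
def ITy : Type := Quot RawTy.Step

namespace ITy

/-- The class of a raw type. -/
def mk (t : RawTy) : ITy := Quot.mk RawTy.Step t

/-- A representative of a type. -/
def out (t : ITy) : RawTy := Quot.out t

theorem mk_out (t : ITy) : mk t.out = t := Quot.out_eq t

theorem sound {t t' : RawTy} (h : RawTy.Step t t') : mk t = mk t' := Quot.sound h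

theorem eqvGen {t t' : RawTy} (h : mk t = mk t') : Relation.EqvGen RawTy.Step t t' :=
  Quot.eqvGen_exact h

/-- The type `n`. -/
def nat (n : ℕ) : ITy := mk (.nat n)

/-- The type `m ⊸ b`. -/
def arr (m : Multiset ITy) (b : ITy) : ITy := mk (.arr (m.toList.map out) b.out)

/-- The outermost constructor of a raw type and the classes of its arguments. -/
def rawDest : RawTy → ℕ ⊕ (Multiset ITy × ITy)
  | .nat n => Sum.inl n
  | .arr l b => Sum.inr (((l.map mk : List ITy) : Multiset ITy), mk b)

theorem rawDest_eq {t t' : RawTy} (h : RawTy.Step t t') : rawDest t = rawDest t' := by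
  cases h with
  | perm b h => simp only [rawDest, Multiset.coe_eq_coe.mpr (h.map mk)]
  | left l l' b h => simp only [rawDest, List.map_append, List.map_cons, sound h]
  | right l h => simp only [rawDest, sound h]

/-- The outermost constructor of a type and its arguments. -/
def dest (t : ITy) : ℕ ⊕ (Multiset ITy × ITy) := Quot.lift rawDest (fun _ _ h => rawDest_eq h) t

@[simp] theorem dest_nat (n : ℕ) : dest (nat n) = Sum.inl n := rfl

@[simp] theorem dest_arr (m : Multiset ITy) (b : ITy) : dest (arr m b) = Sum.inr (m, b) := by
  have h : mk ∘ out = id := funext mk_out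
  change rawDest (.arr (m.toList.map out) b.out) = _
  simp only [rawDest, List.map_map, h, List.map_id, mk_out, Multiset.coe_toList]

theorem nat_injective : Function.Injective nat := fun n n' h => by
  simpa using congrArg dest h

theorem arr_inj {m m' : Multiset ITy} {b b' : ITy} (h : arr m b = arr m' b') :
    m = m' ∧ b = b' := by
  simpa using congrArg dest h

theorem nat_ne_arr (n : ℕ) (m : Multiset ITy) (b : ITy) : nat n ≠ arr m b := fun h => by
  simpa using congrArg dest h

theorem mk_arr_congr {l l' : List RawTy} {b b' : RawTy} (hl : l.map mk = l'.map mk)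
    (hb : mk b = mk b') : mk (.arr l b) = mk (.arr l' b') := by
  have key : ∀ (q p q' : List RawTy), q.map mk = q'.map mk →
      mk (.arr (p ++ q) b) = mk (.arr (p ++ q') b) := by
    intro q
    induction q with
    | nil =>
      intro p q' h
      cases q' with
      | nil => rfl
      | cons x q' => simp at h
    | cons a q ih =>
      intro p q' h
      cases q' with
      | nil => simp at h
      | cons a' q' =>
        simp only [List.map_cons, List.cons.injEq] at h
        have h1 : mk (.arr (p ++ a :: q) b) = mk (.arr (p ++ a' :: q) b) := by
          have h0 := eqvGen h.1
          clear h ih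
          induction h0 with
          | rel x y hxy => exact sound (.left p q b hxy)
          | refl x => rfl
          | symm x y _ e => exact e.symm
          | trans x y z _ _ e e' => exact e.trans e'
        have h2 := ih (p ++ [a']) q' h.2
        simp only [List.append_assoc, List.singleton_append] at h2
        exact h1.trans h2
  refine (key l [] l' hl).trans ?_
  have h0 := eqvGen hb
  clear hb key hl
  induction h0 with
  | rel x y hxy => exact sound (.right l' hxy)
  | refl x => rfl
  | symm x y _ e => exact e.symm
  | trans x y z _ _ e e' => exact e.trans e'

/-- Every intersection type is of one of the two forms. -/
theorem cases_form (t : ITy) : (∃ n, t = nat n) ∨ ∃ m b, t = arr m b := by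
  have h : ∀ r : RawTy, (∃ n, mk r = nat n) ∨ ∃ m b, mk r = arr m b := by
    intro r
    cases r with
    | nat n => exact Or.inl ⟨n, rfl⟩
    | arr l b =>
      refine Or.inr ⟨((l.map mk : List ITy) : Multiset ITy), mk b, ?_⟩
      have hp : (((l.map mk : List ITy) : Multiset ITy).toList).Perm (l.map mk) := by
        rw [← Multiset.coe_eq_coe, Multiset.coe_toList]
      refine Eq.trans ?_ (sound (RawTy.Step.perm _ (hp.map out))).symm
      refine mk_arr_congr ?_ (mk_out _).symm
      have e : mk ∘ out = id := funext mk_out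
      simp only [List.map_map, ← Function.comp_assoc, e, Function.id_comp]
  rw [← mk_out t]
  exact h t.out

end ITy

/-- The set that interprets a simple type: `⟦Bool⟧ = {0, 1}`, `⟦N⟧ = ℕ`, and `⟦A → B⟧` is the set
of the `m ⊸ b` with `m` a finite multiset over `⟦A⟧` and `b ∈ ⟦B⟧`; the pair `(m, b)` is
identified with the type `m ⊸ b`. -/
def Ty.den : Ty → Set ITy
  | .bool => {ITy.nat 0, ITy.nat 1}
  | .nat => Set.range ITy.nat
  | .arr A B => {t | ∃ m b, t = ITy.arr m b ∧ (∀ a ∈ m, a ∈ A.den) ∧ b ∈ B.den}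

/-- Contexts of intersection types: functions from variables to finite multisets of types, all
empty but finitely many. `γ (x, a)` is the multiplicity of `a` in `γ(x)`, so that contexts are
the monomials in the variables `x_a`, and are added variable-wise. -/
abbrev ICtx : Type := (ℕ × ITy) →₀ ℕ

/-- The context `x : [a]`. -/
def ICtx.single (x : ℕ) (a : ITy) : ICtx := Finsupp.single (x, a) 1

open Classical in
/-- The context with `m` for the variable `0` and `γ(x)` for the variable `x + 1`. -/
def ICtx.cons (m : Multiset ITy) (γ : ICtx) : ICtx :=
  (Multiset.toFinsupp m).mapDomain (fun a => ((0 : ℕ), a)) +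
    γ.mapDomain (fun p => (p.1 + 1, p.2))

/-- `(γ, a)` refines `(Γ, A)`: `a ∈ ⟦A⟧`, the multiset `γ(x)` is over `⟦Γ(x)⟧` for every declared
variable `x`, and it is empty for the other variables. -/
def Adequate (Γ : List Ty) (A : Ty) (γ : ICtx) (a : ITy) : Prop :=
  a ∈ A.den ∧ ∀ (x : ℕ) (b : ITy), γ (x, b) ≠ 0 → ∃ B, Γ[x]? = some B ∧ b ∈ B.den

/-! ### Parametric weighted relational semantics -/

/-- The variables `X_i = (i, true)` and `X̄_i = (i, false)`. -/
abbrev Par (k : ℕ) : Type := Fin k × Bool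

/-- Formal power series over `ℕ∞` in the variables `X_i, X̄_i`. -/
abbrev Coef (k : ℕ) : Type := MvPowerSeries (Par k) ℕ∞

/-- Formal power series over `Coef k` in the variables `x_a`. -/
abbrev FPS (k : ℕ) : Type := MvPowerSeries (ℕ × ITy) (Coef k)

/-- Arbitrary sums of formal power series, coefficientwise: in `ℕ∞` the sum of a family is the
supremum of its finite subsums. -/
def FPS.sum {k : ℕ} {ι : Type} (f : ι → FPS k) : FPS k := fun γ μ =>
  ⨆ S : Finset ι, ∑ i ∈ S, MvPowerSeries.coeff μ (MvPowerSeries.coeff γ (f i))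

/-- Supremum of a sequence of formal power series, coefficientwise. -/
def FPS.sup {k : ℕ} (f : ℕ → FPS k) : FPS k := fun γ μ =>
  ⨆ n : ℕ, MvPowerSeries.coeff μ (MvPowerSeries.coeff γ (f n))

/-- Application: `(f g)_a = ∑_{m} f_{m ⊸ a} ∏_{b ∈ m} g_b`, where `m` ranges over the finite
multisets over `⟦B⟧`. -/
def FPS.app {k : ℕ} (B : Ty) (f g : ITy → FPS k) (a : ITy) : FPS k :=
  FPS.sum fun m : {m : Multiset ITy // ∀ b ∈ m, b ∈ B.den} =>
    f (ITy.arr m.1 a) * (m.1.map g).prod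

/-- The finite approximants of the least fixed point. -/
def FPS.approx {k : ℕ} (A : Ty) (f : ITy → FPS k) : ℕ → ITy → FPS k
  | 0 => fun _ => 0
  | n + 1 => FPS.app A f (FPS.approx A f n)

open Classical in
/-- The parametric interpretation of a typing derivation of `Γ ⊢ M : A`: a family, indexed by the
`a ∈ ⟦A⟧`, of formal power series in the variables `X_i, X̄_i` and `x_b` with `b ∈ ⟦Γ(x)⟧`.
(Values at an index or a monomial that does not refine `(Γ, A)` have no meaning, and are not used
in any value that does.) -/
def Deriv.sem {k : ℕ} {Γ : List Ty} {M : Term k} {A : Ty} : Deriv Γ M A → ITy → FPS k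
  | .zeroNat => fun a => if a = ITy.nat 0 then 1 else 0
  | .zeroBool => fun a => if a = ITy.nat 0 then 1 else 0
  | .oneBool => fun a => if a = ITy.nat 1 then 1 else 0
  | .succ d => fun a =>
    match a.dest with
    | Sum.inl (n + 1) => d.sem (ITy.nat n)
    | _ => 0
  | .pred d => fun a =>
    match a.dest with
    | Sum.inl 0 => d.sem (ITy.nat 0) + d.sem (ITy.nat 1)
    | Sum.inl (n + 1) => d.sem (ITy.nat (n + 2))
    | Sum.inr _ => 0
  | .cast d => fun a => if a = ITy.nat 0 ∨ a = ITy.nat 1 then d.sem a else 0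
  | .var x _ => fun a => MvPowerSeries.X (x, a)
  | .lam d => fun a =>
    match a.dest with
    | Sum.inl _ => 0
    | Sum.inr (m, b) => fun γ => MvPowerSeries.coeff (ICtx.cons m γ) (d.sem b)
  | .app (A := B) d e => FPS.app B d.sem e.sem
  | .ifz d e f => fun a =>
    d.sem (ITy.nat 0) * e.sem a + FPS.sum (fun n : ℕ => d.sem (ITy.nat (n + 1))) * f.sem a
  | .choice i d e => fun a =>
    MvPowerSeries.C (MvPowerSeries.X (i, true)) * d.sem a +
      MvPowerSeries.C (MvPowerSeries.X (i, false)) * e.sem a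
  | .fix (A := A) d => fun a => FPS.sup fun n => FPS.approx A d.sem n a

/-- The coefficient `⟦Π⟧_{γ,a}`, a formal power series in the variables `X_i, X̄_i`. -/
def Deriv.semAt {k : ℕ} {Γ : List Ty} {M : Term k} {A : Ty} (d : Deriv Γ M A) (γ : ICtx)
    (a : ITy) : Coef k :=
  MvPowerSeries.coeff γ (d.sem a)

/-- The support of a formal power series. -/
def supp {k : ℕ} (s : Coef k) : Set (Par k →₀ ℕ) := {μ | MvPowerSeries.coeff μ s ≠ 0}

/-- The value `μ · q = ∑ μ(V) q_V` in `[0, ∞]`. -/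
def pairing {k : ℕ} (μ : Par k →₀ ℕ) (q : Par k → ℝ≥0∞) : ℝ≥0∞ := ∑ V, (μ V : ℝ≥0∞) * q V

/-- The tropicalization of `s`: the function `q ↦ inf { μ · q | μ ∈ supp s }` on `[0, ∞]^{2k}`. -/
def tropicalization {k : ℕ} (s : Coef k) (q : Par k → ℝ≥0∞) : ℝ≥0∞ := ⨅ μ ∈ supp s, pairing μ q

/-! ### Minimal Newton polytope and minimal polynomials -/

/-- The vertices of the Newton polytope of a set `S` of monomials: the monomials that are extreme
points of the convex hull of `S`. -/
def newtonVertices {k : ℕ} (S : Set (Par k →₀ ℕ)) : Set (Par k →₀ ℕ) :=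
  {μ | (fun V => (μ V : ℝ)) ∈
    (convexHull ℝ ((fun (ν : Par k →₀ ℕ) (V : Par k) => (ν V : ℝ)) '' S)).extremePoints ℝ}

/-- The minimal monomials of `S`: the vertices of its minimal Newton polytope, that is, the
vertices of its Newton polytope that are minimal among these for the pointwise order. -/
def minMonomials {k : ℕ} (S : Set (Par k →₀ ℕ)) : Set (Par k →₀ ℕ) :=
  {μ | Minimal (· ∈ newtonVertices S) μ}

/-- Formal polynomials over the tropical semiring `[0, ∞]` in the variables `X_i, X̄_i`. -/
abbrev Poly (k : ℕ) : Type := MvPolynomial (Par k) (Tropical ℝ≥0∞)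

open Classical in
/-- `s_min`, the all-one polynomial on the vertices of the minimal Newton polytope of `s`. -/
def polyMin {k : ℕ} (s : Poly k) : Poly k :=
  ∑ μ ∈ s.support.filter (· ∈ minMonomials (s.support : Set (Par k →₀ ℕ))),
    MvPolynomial.monomial μ 1

/-- `VN(s₁, …, sₙ)`, the minimal polynomial of the product. -/
def polyVN {k : ℕ} (S : Multiset (Poly k)) : Poly k := polyMin S.prod

/-! ### The tropical intersection type system -/

/-- A typing `γ ⊢^s a`. -/
structure Entry (k : ℕ) : Type where
  ctx : ICtx
  poly : Poly k
  ty : ITy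

/-- The pair `(γ, a)` of a typing `γ ⊢^s a`. -/
def Entry.key {k : ℕ} (e : Entry k) : ICtx × ITy := (e.ctx, e.ty)

/-- A finite family of typings (a pre-judgement, its term left aside). -/
abbrev PreJ (k : ℕ) : Type := Multiset (Entry k)

/-- A pre-judgement is a judgement when its pairs `(γ, a)` are pairwise distinct and its
polynomials are minimal. -/
def PreJ.IsJudgement {k : ℕ} (J : PreJ k) : Prop :=
  (J.map Entry.key).Nodup ∧ ∀ e ∈ J, polyMin e.poly = e.poly

open Classical in
/-- Merging: for every pair `(γ, a)` of the family, the sum of its polynomials, minimized. -/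
def PreJ.merge {k : ℕ} (J : PreJ k) : PreJ k :=
  (J.map Entry.key).toFinset.val.map fun p =>
    ⟨p.1, polyMin ((J.filter fun e => e.key = p).map Entry.poly).sum, p.2⟩

/-- One instance of application: a typing `γ ⊢^s [a₁, …, aₚ] ⊸ b` of the function and typings
`δⱼ ⊢^{sⱼ} aⱼ` of the argument, one for each element of the multiset `[a₁, …, aₚ]`. -/
structure AppInst (k : ℕ) : Type where
  fn : Entry k
  args : Multiset (Entry k)
  res : ITy
  eq : fn.ty = ITy.arr (args.map Entry.ty) res

/-- The typing `γ + ∑ⱼ δⱼ ⊢^{VN(s, s₁, …, sₚ)} b` that an instance of application produces. -/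
def AppInst.concl {k : ℕ} (t : AppInst k) : Entry k :=
  ⟨t.fn.ctx + (t.args.map Entry.ctx).sum, polyVN (t.fn.poly ::ₘ t.args.map Entry.poly), t.res⟩

/-- The finite family `L` of instances of application is collected from the judgements `J` (of
the function) and `J'` (of the argument), and every typing in these is used in it; a typing may be
used several times. -/
def IsAppFamily {k : ℕ} (J J' : PreJ k) (L : Multiset (AppInst k)) : Prop :=
  (∀ t ∈ L, t.fn ∈ J ∧ ∀ e ∈ t.args, e ∈ J') ∧
    (∀ e ∈ J, ∃ t ∈ L, t.fn = e) ∧ ∀ e ∈ J', ∃ t ∈ L, e ∈ t.args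

/-- One instance of the conditional: a typing `γ ⊢^s 0` (resp. `γ ⊢^s n + 1`) of the guard, in
`J`, and a typing `δ ⊢^t a` of the first branch, in `J₀` (resp. of the second branch, in `J₁`). -/
def IsIfzInst {k : ℕ} (J J₀ J₁ : PreJ k) (p : Entry k × Entry k) : Prop :=
  p.1 ∈ J ∧ ((p.1.ty = ITy.nat 0 ∧ p.2 ∈ J₀) ∨ ((∃ n, p.1.ty = ITy.nat (n + 1)) ∧ p.2 ∈ J₁))

/-- The typing `γ + δ ⊢^{VN(s, t)} a` that an instance of the conditional produces. -/
def ifzConcl {k : ℕ} (p : Entry k × Entry k) : Entry k :=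
  ⟨p.1.ctx + p.2.ctx, polyVN {p.1.poly, p.2.poly}, p.2.ty⟩

/-- The typings `γ ⊢^{s V} a` for the typings `γ ⊢^s a` in `J`. -/
def PreJ.scale {k : ℕ} (J : PreJ k) (V : Par k) : PreJ k :=
  J.map fun e => ⟨e.ctx, e.poly * MvPolynomial.X V, e.ty⟩

/-- Derivations of `M : ⟨γ_j ⊢^{s_j} a_j⟩_j` in the tropical intersection type system. -/
inductive IDeriv {k : ℕ} : Term k → PreJ k → Type
  | empty (M : Term k) : IDeriv M 0
  | var (x : ℕ) (I : Finset ITy) :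
      IDeriv (.var x) (I.val.map fun a => ⟨ICtx.single x a, 1, a⟩)
  | num {N : Term k} (n : ℕ) (h : N = Term.numeral n) : IDeriv N {⟨0, 1, ITy.nat n⟩}
  | succ {M : Term k} (L : Multiset (ICtx × Poly k × ℕ)) :
      IDeriv M (L.map fun p => ⟨p.1, p.2.1, ITy.nat p.2.2⟩) →
      IDeriv (.succ M) (L.map fun p => ⟨p.1, p.2.1, ITy.nat (p.2.2 + 1)⟩)
  | pred {M : Term k} (L : Multiset (ICtx × Poly k × ℕ))
      (h : PreJ.IsJudgement (L.map fun p => ⟨p.1, p.2.1, ITy.nat (p.2.2 - 1)⟩)) :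
      IDeriv M (L.map fun p => ⟨p.1, p.2.1, ITy.nat p.2.2⟩) →
      IDeriv (.pred M) (L.map fun p => ⟨p.1, p.2.1, ITy.nat (p.2.2 - 1)⟩)
  | lam {M : Term k} (L : Multiset (ICtx × Multiset ITy × Poly k × ITy)) :
      IDeriv M (L.map fun p => ⟨ICtx.cons p.2.1 p.1, p.2.2.1, p.2.2.2⟩) →
      IDeriv (.lam M) (L.map fun p => ⟨p.1, p.2.2.1, ITy.arr p.2.1 p.2.2.2⟩)
  | choice {M N : Term k} (i : Fin k) {J J' : PreJ k} :
      IDeriv M J → IDeriv N J' →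
      IDeriv (.choice i M N) (PreJ.merge (J.scale (i, true) + J'.scale (i, false)))
  | ifz {M N P : Term k} {J J₀ J₁ : PreJ k} (L : Multiset (Entry k × Entry k))
      (hJ : ∀ e ∈ J, e.ty ∈ Set.range ITy.nat) (hL : ∀ p ∈ L, IsIfzInst J J₀ J₁ p) :
      IDeriv M J → IDeriv N J₀ → IDeriv P J₁ →
      IDeriv (.ifz M N P) (PreJ.merge (L.map ifzConcl))
  | app {M N : Term k} {J J' : PreJ k} (L : Multiset (AppInst k)) (hL : IsAppFamily J J' L) :
      IDeriv M J → IDeriv N J' → IDeriv (.app M N) (PreJ.merge (L.map AppInst.concl))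
  | fix {M : Term k} {J J' : PreJ k} (L : Multiset (AppInst k)) (hL : IsAppFamily J J' L) :
      IDeriv M J → IDeriv (.fix M) J' → IDeriv (.fix M) (PreJ.merge (L.map AppInst.concl))

/-- The number of fixpoint rules in the cluster at the end of a derivation (for a term `Y M`). -/
def IDeriv.cluster {k : ℕ} {N : Term k} {J : PreJ k} : IDeriv N J → ℕ
  | .fix _ _ _ e => e.cluster + 1
  | _ => 0

/-- The term that replaces `N` when a cluster of `h` fixpoint rules at the end of a derivation is
unfolded: `Y M` becomes `M^(h) y`, any other term is left as it is. -/
def Term.unfold {k : ℕ} (N : Term k) (h y : ℕ) : Term k :=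
  match N with
  | .fix M => M.iter h (.var y)
  | N => N

/-- The derivation for `M^(h) y` that replaces by application rules the `h` fixpoint rules in the
cluster at the end of a derivation for `Y M`. (A derivation for another term is left as it is.) -/
def IDeriv.unfold {k : ℕ} (y : ℕ) {N : Term k} {J : PreJ k} :
    (d : IDeriv N J) → IDeriv (N.unfold d.cluster y) J
  | .empty _ => .empty _
  | .var x I => .var x I
  | .num n h => .num n (by subst h; cases n <;> rfl)
  | .succ L d => .succ L d
  | .pred L h d => .pred L h d
  | .lam L d => .lam L d
  | .choice i d e => .choice i d e
  | .ifz L hJ hL d e f => .ifz L hJ hL d e f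
  | .app L hL d e => .app L hL d e
  | .fix L hL d e => .app L hL d (e.unfold y)

/-- Refinement of typing derivations by derivations in the tropical intersection type system. The
rules match those of the typing derivation, except that the cast is skipped, and that a fixpoint
is unfolded as many times as the derivation does. Every typing of a refining derivation refines
`(Γ, A)`: this is required at the variables, and propagates from there to all other rules. -/
inductive Refines {k : ℕ} : {Γ : List Ty} → {M : Term k} → {A : Ty} → {J : PreJ k} →
    IDeriv M J → Deriv Γ M A → Prop
  | empty {Γ M A} (d : Deriv Γ M A) : Refines (.empty M) d
  | zeroNat {Γ} : Refines (.num 0 rfl) (Deriv.zeroNat (Γ := Γ))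
  | zeroBool {Γ} : Refines (.num 0 rfl) (Deriv.zeroBool (Γ := Γ))
  | oneBool {Γ} : Refines (.num 1 rfl) (Deriv.oneBool (Γ := Γ))
  | var {Γ A} (x : ℕ) (h : Γ[x]? = some A) (I : Finset ITy) (hI : ∀ a ∈ I, a ∈ A.den) :
      Refines (.var x I) (Deriv.var (Γ := Γ) x h)
  | cast {Γ M J} {π : IDeriv M J} {d : Deriv Γ M .bool} : Refines π d → Refines π (.cast d)
  | succ {Γ M L} {π : IDeriv M _} {d : Deriv Γ M .nat} :
      Refines π d → Refines (.succ L π) (.succ d)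
  | pred {Γ M L h} {π : IDeriv M _} {d : Deriv Γ M .nat} :
      Refines π d → Refines (.pred L h π) (.pred d)
  | lam {Γ M A B L} {π : IDeriv M _} {d : Deriv (A :: Γ) M B} :
      Refines π d → Refines (.lam L π) (.lam d)
  | choice {Γ M N A J J'} (i : Fin k) {π : IDeriv M J} {ρ : IDeriv N J'}
      {d : Deriv Γ M A} {e : Deriv Γ N A} :
      Refines π d → Refines ρ e → Refines (.choice i π ρ) (.choice i d e)
  | ifz {Γ M N P A J J₀ J₁ L hJ hL} {π : IDeriv M J} {ρ : IDeriv N J₀} {σ : IDeriv P J₁}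
      {d : Deriv Γ M .nat} {e : Deriv Γ N A} {f : Deriv Γ P A} :
      Refines π d → Refines ρ e → Refines σ f → Refines (.ifz L hJ hL π ρ σ) (.ifz d e f)
  | app {Γ M N A B J J' L hL} {π : IDeriv M J} {ρ : IDeriv N J'}
      {d : Deriv Γ M (.arr A B)} {e : Deriv Γ N A} :
      Refines π d → Refines ρ e → Refines (.app L hL π ρ) (.app d e)
  | fix {Γ M A J} {π : IDeriv (.fix M) J} {d : Deriv Γ M (.arr A A)} :
      Refines (π.unfold Γ.length) (d.unfold π.cluster) → Refines π (.fix d)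

end PCFX

end

noncomputable section

namespace PCFX

open scoped ENNReal Pointwise

/-! ### Rigid families of labelled keys -/

section Rigid

variable {κ ι N : Type*} [AddCommMonoid N]

/-! The proof replaces vertices by a discrete notion that survives decomposition. A vertex `μ` of a
Newton polytope is not a proper midpoint of two monomials of the support. More generally, a finite
family of pairs `(γ, a)`, each labelled with a monomial of its support, is `Rigid` when its total
label is not a proper midpoint in the Minkowski sum of the supports.

Two facts about rigid families carry the completeness proof. Equal pairs have equal labels
(`Rigid.eq_of_fst_eq`): otherwise the two labels could be traded for two copies of either one, with
the total as midpoint. So every pair needs just one monomial; monomials are minimal, `VN` multiplies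
them, and merging adds equal monomials, which changes nothing since tropical addition is idempotent.
Moreover, rigidity passes to subterms (`Rigid.bind`): a midpoint for the part of the family that
concerns a subterm becomes one for the whole family when the other labels are kept fixed. Since
coefficients in `ℕ∞` do not cancel, supports are computed by unions and Minkowski sums, and their
decompositions are the instances of the typing rules. Induction on the typing derivation
(`completeFor`) then derives every rigid family. At a fixpoint, a finite family lies in the support
of one finite approximant, that is, of an iterated application.

For the infimum formula, `Refines.sound` gives the converse inclusion: monomials of refining
derivations lie in the support of the interpretation. By Dickson's lemma the minimum of `μ · q` on a
nonempty support is attained, and a monomial order selects a minimizer that is not a midpoint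
(`exists_rigid_forall_pairing_le`), to which completeness applies. -/

theorem mem_multiset_sum_map_iff {N : Type*} [AddCommMonoid N] (S : κ → Set N) (T : Multiset κ)
    (s : N) :
    s ∈ (T.map S).sum ↔
      ∃ K : Multiset (κ × N), K.map Prod.fst = T ∧ (∀ x ∈ K, x.2 ∈ S x.1) ∧
        (K.map Prod.snd).sum = s := by
  induction T using Multiset.induction_on generalizing s with
  | empty =>
    simp only [Multiset.map_zero, Multiset.sum_zero, Set.mem_zero, Multiset.map_eq_zero]
    constructor
    · rintro rfl
      exact ⟨0, by simp⟩
    · rintro ⟨K, rfl, -, rfl⟩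
      simp
  | cons a T ih =>
    simp only [Multiset.map_cons, Multiset.sum_cons, Set.mem_add]
    constructor
    · rintro ⟨u, hu, v, hv, rfl⟩
      obtain ⟨K, rfl, hK, rfl⟩ := (ih v).mp hv
      refine ⟨(a, u) ::ₘ K, by simp, ?_, by simp⟩
      intro x hx
      rcases Multiset.mem_cons.mp hx with rfl | hx
      · exact hu
      · exact hK x hx
    · rintro ⟨K, hK, hS, rfl⟩
      have ha : a ∈ K.map Prod.fst := by rw [hK]; exact Multiset.mem_cons_self a T
      obtain ⟨x, hx, rfl⟩ := Multiset.mem_map.mp ha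
      obtain ⟨K', rfl⟩ := Multiset.exists_cons_of_mem hx
      rw [Multiset.map_cons, Multiset.cons_inj_right] at hK
      refine ⟨x.2, hS x (Multiset.mem_cons_self _ _), (K'.map Prod.snd).sum, (ih _).mpr
        ⟨K', hK, fun y hy => hS y (Multiset.mem_cons_of_mem hy), rfl⟩, by simp⟩

/-- A finite family of keys labelled with elements of the sets `S` of their keys is rigid when the
sum of its labels is not a proper midpoint in the Minkowski sum of these sets. -/
def Rigid (S : κ → Set N) (K : Multiset (κ × N)) : Prop :=
  (∀ x ∈ K, x.2 ∈ S x.1) ∧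
    ∀ s ∈ (K.map fun x => S x.1).sum, ∀ s' ∈ (K.map fun x => S x.1).sum,
      s + s' = (K.map Prod.snd).sum + (K.map Prod.snd).sum → s = (K.map Prod.snd).sum

variable {S : κ → Set N} {K : Multiset (κ × N)}

theorem sum_mem_sum_of_forall_mem {K : Multiset (κ × N)} (hK : ∀ x ∈ K, x.2 ∈ S x.1) :
    (K.map Prod.snd).sum ∈ (K.map fun x => S x.1).sum := by
  have := (mem_multiset_sum_map_iff S (K.map Prod.fst) (K.map Prod.snd).sum).mpr ⟨K, rfl, hK, rfl⟩
  simpa [Multiset.map_map, Function.comp_def] using this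

/-- With `R` the sum of the other labels, both `2 x.2 + R` and `2 y.2 + R` lie in the Minkowski sum,
because `x` and `y` share a key. Their midpoint is the total label `x.2 + y.2 + R`. -/
theorem Rigid.eq_of_fst_eq [IsCancelAdd N] (h : Rigid S K) {x y : κ × N} (hx : x ∈ K) (hy : y ∈ K)
    (hxy : x.1 = y.1) : x = y := by
  by_contra hne
  obtain ⟨K', rfl⟩ := Multiset.exists_cons_of_mem hx
  have hy' : y ∈ K' := (Multiset.mem_cons.mp hy).resolve_left fun e => hne e.symm
  obtain ⟨K'', rfl⟩ := Multiset.exists_cons_of_mem hy'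
  have hxS := h.1 x hx
  have hyS := h.1 y hy
  have hR := sum_mem_sum_of_forall_mem (S := S) (K := K'') fun z hz =>
    h.1 z (Multiset.mem_cons_of_mem (Multiset.mem_cons_of_mem hz))
  have key := h.2 (x.2 + (x.2 + (K''.map Prod.snd).sum))
    (by
      simp only [Multiset.map_cons, Multiset.sum_cons]
      exact Set.add_mem_add hxS (Set.add_mem_add (hxy ▸ hxS) hR))
    (y.2 + (y.2 + (K''.map Prod.snd).sum))
    (by
      simp only [Multiset.map_cons, Multiset.sum_cons]
      exact Set.add_mem_add (hxy ▸ hyS) (Set.add_mem_add hyS hR))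
    (by
      simp only [Multiset.map_cons, Multiset.sum_cons]
      abel)
  simp only [Multiset.map_cons, Multiset.sum_cons] at key
  exact hne (Prod.ext hxy (add_right_cancel (add_left_cancel key)))

theorem Rigid.mono {S' : κ → Set N} (h : Rigid S K) (hS : ∀ p, S' p ⊆ S p)
    (hK : ∀ x ∈ K, x.2 ∈ S' x.1) : Rigid S' K := by
  have hsub : (K.map fun x => S' x.1).sum ⊆ (K.map fun x => S x.1).sum := by
    clear h hK
    induction K using Multiset.induction_on with
    | empty => simp
    | cons a K ih =>
      simp only [Multiset.map_cons, Multiset.sum_cons]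
      exact Set.add_subset_add (hS _) ih
  exact ⟨hK, fun s hs s' hs' => h.2 s (hsub hs) s' (hsub hs')⟩

/-- Each member `x` is split into the pieces `f x` and a frozen remainder `c x`. Translation by the
total remainder maps the Minkowski sum for the pieces into the one for `K` and preserves midpoints.
The pieces are typings of a subterm, the remainder what the rest of the term contributes. -/
theorem Rigid.bind [IsCancelAdd N] {S' : ι → Set N} (h : Rigid S K) (f : κ × N → Multiset (ι × N))
    (c : κ × N → N) (hsum : ∀ x ∈ K, ((f x).map Prod.snd).sum + c x = x.2)
    (hmem : ∀ x ∈ K, ∀ y ∈ f x, y.2 ∈ S' y.1)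
    (hsub : ∀ x ∈ K, ∀ s ∈ ((f x).map fun y => S' y.1).sum, s + c x ∈ S x.1) :
    Rigid S' (K.bind f) := by
  have hS : ∀ s ∈ ((K.bind f).map fun y => S' y.1).sum,
      s + (K.map c).sum ∈ (K.map fun x => S x.1).sum := by
    clear h hsum hmem
    induction K using Multiset.induction_on with
    | empty => simp
    | cons a K ih =>
      intro s hs
      simp only [Multiset.cons_bind, Multiset.map_add, Multiset.sum_add, Multiset.map_cons,
        Multiset.sum_cons] at hs ⊢
      obtain ⟨u, hu, v, hv, rfl⟩ := Set.mem_add.mp hs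
      rw [add_add_add_comm]
      exact Set.add_mem_add (hsub a (Multiset.mem_cons_self a K) u hu)
        (ih (fun x hx => hsub x (Multiset.mem_cons_of_mem hx)) v hv)
  have hP : ((K.bind f).map Prod.snd).sum + (K.map c).sum = (K.map Prod.snd).sum := by
    clear h hmem hsub hS
    induction K using Multiset.induction_on with
    | empty => simp
    | cons a K ih =>
      simp only [Multiset.cons_bind, Multiset.map_add, Multiset.sum_add, Multiset.map_cons,
        Multiset.sum_cons]
      rw [add_add_add_comm, ih fun x hx => hsum x (Multiset.mem_cons_of_mem hx),
        hsum a (Multiset.mem_cons_self a K)]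
  refine ⟨fun y hy => ?_, fun s hs s' hs' e => ?_⟩
  · obtain ⟨x, hx, hy⟩ := Multiset.mem_bind.mp hy
    exact hmem x hx y hy
  · have := h.2 _ (hS s hs) _ (hS s' hs') (by
      rw [← hP, add_add_add_comm, e, add_add_add_comm])
    rw [← hP] at this
    exact add_right_cancel this

theorem Rigid.map [IsCancelAdd N] {S' : ι → Set N} (h : Rigid S K) (g : κ × N → ι)
    (hmem : ∀ x ∈ K, x.2 ∈ S' (g x)) (hsub : ∀ x ∈ K, S' (g x) ⊆ S x.1) :
    Rigid S' (K.map fun x => (g x, x.2)) := by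
  have := h.bind (S' := S') (fun x => {(g x, x.2)}) (fun _ => 0) (by simp)
    (by simpa using hmem) (by simpa [Set.subset_def] using hsub)
  rwa [Multiset.bind_singleton] at this

theorem rigid_singleton (p : κ) (μ : N) (hμ : μ ∈ S p)
    (h : ∀ s ∈ S p, ∀ s' ∈ S p, s + s' = μ + μ → s = μ) : Rigid S {(p, μ)} := by
  simpa [Rigid] using And.intro hμ h

end Rigid

theorem fst_multiset_sum {N N' : Type*} [AddCommMonoid N] [AddCommMonoid N']
    (s : Multiset (N × N')) : s.sum.1 = (s.map Prod.fst).sum :=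
  map_multiset_sum (AddMonoidHom.fst N N') s

theorem snd_multiset_sum {N N' : Type*} [AddCommMonoid N] [AddCommMonoid N']
    (s : Multiset (N × N')) : s.sum.2 = (s.map Prod.snd).sum :=
  map_multiset_sum (AddMonoidHom.snd N N') s

/-! ### Supports of formal power series -/

/-- Monomials in the variables `X_i, X̄_i`. -/
abbrev Mon (k : ℕ) : Type := Par k →₀ ℕ

/-- The support of a family of power series, as a set of monomials for every pair `(γ, a)`. -/
def famSupp {k : ℕ} (f : ITy → FPS k) (p : ICtx × ITy) : Set (Mon k) :=
  supp (MvPowerSeries.coeff p.1 (f p.2))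

/-- The support of a power series in both kinds of variables. -/
def FPS.supp {k : ℕ} (f : FPS k) : Set (ICtx × Mon k) :=
  {x | MvPowerSeries.coeff x.2 (MvPowerSeries.coeff x.1 f) ≠ 0}

section Supp

variable {k : ℕ}

theorem mem_famSupp {f : ITy → FPS k} {p : ICtx × ITy} {μ : Mon k} :
    μ ∈ famSupp f p ↔ (p.1, μ) ∈ (f p.2).supp := Iff.rfl

@[simp] theorem FPS.supp_zero : (0 : FPS k).supp = ∅ := by
  ext x
  simp [FPS.supp]

theorem FPS.supp_add (f g : FPS k) : (f + g).supp = f.supp ∪ g.supp := by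
  ext x
  simp only [FPS.supp, map_add, Set.mem_ofPred_eq, Set.mem_union, ne_eq, add_eq_zero]
  tauto

/-- In `ℕ∞` a sum vanishes only if all its terms do, and there are no zero divisors, so no monomial
of a product is lost. -/
theorem FPS.supp_mul (f g : FPS k) : (f * g).supp = f.supp + g.supp := by
  classical
  ext ⟨γ, μ⟩
  simp only [FPS.supp, MvPowerSeries.coeff_mul, map_sum, Set.mem_ofPred_eq, Set.mem_add, ne_eq,
    Finset.sum_eq_zero_iff, not_forall, mul_eq_zero, not_or]
  constructor
  · rintro ⟨⟨γ₁, γ₂⟩, hγ, ⟨μ₁, μ₂⟩, hμ, h₁, h₂⟩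
    exact ⟨(γ₁, μ₁), h₁, (γ₂, μ₂), h₂,
      Prod.ext (Finset.HasAntidiagonal.mem_antidiagonal.mp hγ)
        (Finset.HasAntidiagonal.mem_antidiagonal.mp hμ)⟩
  · rintro ⟨⟨γ₁, μ₁⟩, h₁, ⟨γ₂, μ₂⟩, h₂, h⟩
    obtain ⟨rfl, rfl⟩ := Prod.mk.inj h
    exact ⟨(γ₁, γ₂), Finset.HasAntidiagonal.mem_antidiagonal.mpr rfl, (μ₁, μ₂),
      Finset.HasAntidiagonal.mem_antidiagonal.mpr rfl,
      h₁, h₂⟩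

theorem FPS.mem_supp_one {x : ICtx × Mon k} : x ∈ (1 : FPS k).supp ↔ x = 0 := by
  classical
  simp only [FPS.supp, MvPowerSeries.coeff_one, Set.mem_ofPred_eq]
  rcases x with ⟨γ, μ⟩
  by_cases h : γ = 0 <;> by_cases h' : μ = 0 <;>
    simp [h, h', MvPowerSeries.coeff_one, Prod.ext_iff]

theorem FPS.supp_one : (1 : FPS k).supp = 0 := by
  ext x
  rw [FPS.mem_supp_one, Set.mem_zero]

theorem FPS.supp_multiset_prod (s : Multiset (FPS k)) : s.prod.supp = (s.map FPS.supp).sum := by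
  induction s using Multiset.induction_on with
  | empty => simp [FPS.supp_one]
  | cons a s ih => simp [FPS.supp_mul, ih]

theorem FPS.mem_supp_sum {ι : Type} {f : ι → FPS k} {x : ICtx × Mon k} :
    x ∈ (FPS.sum f).supp ↔ ∃ i, x ∈ (f i).supp := by
  have : MvPowerSeries.coeff x.2 (MvPowerSeries.coeff x.1 (FPS.sum f)) =
    ⨆ S : Finset ι, ∑ i ∈ S, MvPowerSeries.coeff x.2 (MvPowerSeries.coeff x.1 (f i)) := rfl
  simp only [FPS.supp, Set.mem_ofPred_eq, this, ne_eq, ENat.iSup_eq_zero, Finset.sum_eq_zero_iff,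
    not_forall]
  constructor
  · rintro ⟨S, i, -, h⟩
    exact ⟨i, h⟩
  · rintro ⟨i, h⟩
    exact ⟨{i}, i, by simp, h⟩

theorem FPS.mem_supp_sup {f : ℕ → FPS k} {x : ICtx × Mon k} :
    x ∈ (FPS.sup f).supp ↔ ∃ n, x ∈ (f n).supp := by
  have : MvPowerSeries.coeff x.2 (MvPowerSeries.coeff x.1 (FPS.sup f)) =
    ⨆ n, MvPowerSeries.coeff x.2 (MvPowerSeries.coeff x.1 (f n)) := rfl
  simp only [FPS.supp, Set.mem_ofPred_eq, this, ne_eq, ENat.iSup_eq_zero, not_forall]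

theorem FPS.mem_supp_X {v : ℕ × ITy} {x : ICtx × Mon k} :
    x ∈ FPS.supp (k := k) (MvPowerSeries.X v) ↔ x = (Finsupp.single v 1, 0) := by
  classical
  rcases x with ⟨γ, μ⟩
  simp only [FPS.supp, MvPowerSeries.coeff_X, Set.mem_ofPred_eq]
  by_cases h : γ = Finsupp.single v 1 <;> by_cases h' : μ = 0 <;>
    simp [h, h', MvPowerSeries.coeff_one, Prod.ext_iff]

theorem FPS.mem_supp_C_X {V : Par k} {x : ICtx × Mon k} :
    x ∈ FPS.supp (k := k) (MvPowerSeries.C (MvPowerSeries.X V)) ↔ x = (0, Finsupp.single V 1) := by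
  classical
  rcases x with ⟨γ, μ⟩
  simp only [FPS.supp, MvPowerSeries.coeff_C, Set.mem_ofPred_eq]
  by_cases h : γ = 0 <;> by_cases h' : μ = Finsupp.single V 1 <;>
    simp [h, h', MvPowerSeries.coeff_X, Prod.ext_iff]

/-- Pairs `(γ, a)` labelled with a monomial. -/
abbrev Pt (k : ℕ) : Type := (ICtx × ITy) × Mon k

/-- Expanding the product over `m` means choosing one context and one monomial for each occurrence
in `m`. The multiset `K` records these choices and is thus the list of arguments of an instance of
the application rule. -/
theorem mem_famSupp_app {B : Ty} {f g : ITy → FPS k} {p : ICtx × ITy} {μ : Mon k} :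
    μ ∈ famSupp (FPS.app B f g) p ↔
      ∃ (γ₀ : ICtx) (ν₀ : Mon k) (K : Multiset (Pt k)),
        (∀ x ∈ K, x.1.2 ∈ B.den) ∧ (∀ x ∈ K, x.2 ∈ famSupp g x.1) ∧
        ν₀ ∈ famSupp f (γ₀, ITy.arr (K.map fun x => x.1.2) p.2) ∧
        γ₀ + (K.map fun x => x.1.1).sum = p.1 ∧ ν₀ + (K.map Prod.snd).sum = μ := by
  rw [mem_famSupp, FPS.app, FPS.mem_supp_sum]
  simp only [FPS.supp_mul, FPS.supp_multiset_prod, Multiset.map_map, Function.comp_def]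
  constructor
  · rintro ⟨⟨m, hm⟩, h⟩
    obtain ⟨⟨γ₀, ν₀⟩, h₀, y, hy, e⟩ := Set.mem_add.mp h
    obtain ⟨K, rfl, hK, rfl⟩ := (mem_multiset_sum_map_iff (fun b => (g b).supp) m y).mp hy
    have e' := e
    apply_fun Prod.fst at e
    apply_fun Prod.snd at e'
    refine ⟨γ₀, ν₀, K.map fun x => ((x.2.1, x.1), x.2.2), ?_, ?_, ?_, ?_, ?_⟩
    · intro y hy
      obtain ⟨x, hx, rfl⟩ := Multiset.mem_map.mp hy
      exact hm x.1 (Multiset.mem_map.mpr ⟨x, hx, rfl⟩)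
    · intro y hy
      obtain ⟨x, hx, rfl⟩ := Multiset.mem_map.mp hy
      exact hK x hx
    · rw [Multiset.map_map]
      exact h₀
    · refine Eq.trans ?_ e
      simp [Multiset.map_map, fst_multiset_sum]
    · refine Eq.trans ?_ e'
      simp [Multiset.map_map, snd_multiset_sum]
  · rintro ⟨γ₀, ν₀, K, hB, hK, h₀, e, e'⟩
    refine ⟨⟨K.map fun x => x.1.2, by simpa using fun b x y h => hB _ h⟩, ?_⟩
    -- The truncated difference `p.1 - γ₀` is exact: it is the sum of the contexts in `K`.
    refine Set.mem_add.mpr ⟨(γ₀, ν₀), h₀, (p.1 - γ₀, (K.map Prod.snd).sum), ?_, ?_⟩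
    · rw [mem_multiset_sum_map_iff]
      refine ⟨K.map fun x => (x.1.2, (x.1.1, x.2)), ?_, ?_, ?_⟩
      · simp [Multiset.map_map]
      · intro y hy
        obtain ⟨x, hx, rfl⟩ := Multiset.mem_map.mp hy
        exact hK x hx
      · rw [← e, add_tsub_cancel_left]
        ext1
        · simp [Multiset.map_map, fst_multiset_sum]
        · simp [Multiset.map_map, snd_multiset_sum]
    · rw [← e', ← e, add_tsub_cancel_left]
      rfl

theorem famSupp_app_mono {B : Ty} {f g g' : ITy → FPS k}
    (h : ∀ p, famSupp g p ⊆ famSupp g' p) (p : ICtx × ITy) :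
    famSupp (FPS.app B f g) p ⊆ famSupp (FPS.app B f g') p := by
  intro μ hμ
  rw [mem_famSupp_app] at hμ ⊢
  obtain ⟨γ₀, ν₀, K, hB, hK, r⟩ := hμ
  exact ⟨γ₀, ν₀, K, hB, fun x hx => h _ (hK x hx), r⟩

/-- The approximants start from a family with empty support, and application is monotone in its
argument. Hence finitely many monomials of the fixpoint all occur at one common stage. -/
theorem famSupp_approx_mono (A : Ty) (f : ITy → FPS k) {m n : ℕ} (hmn : m ≤ n)
    (p : ICtx × ITy) : famSupp (FPS.approx A f m) p ⊆ famSupp (FPS.approx A f n) p := by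
  have step : ∀ (n : ℕ) (p : ICtx × ITy),
      famSupp (FPS.approx A f n) p ⊆ famSupp (FPS.approx A f (n + 1)) p := by
    intro n
    induction n with
    | zero => intro p μ hμ; simp [FPS.approx, mem_famSupp] at hμ
    | succ n ih => exact famSupp_app_mono ih
  induction hmn with
  | refl => exact subset_rfl
  | step _ ih => exact ih.trans (step _ p)

end Supp

/-! ### Families of typings with monomials -/

section Fam

variable {k : ℕ}

theorem minMonomials_subset (S : Set (Mon k)) : minMonomials S ⊆ newtonVertices S :=
  fun _ h => h.1

theorem minMonomials_singleton (μ : Mon k) : minMonomials ({μ} : Set (Mon k)) = {μ} := by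
  have h : newtonVertices ({μ} : Set (Mon k)) = {μ} := by
    ext ν
    simp only [newtonVertices, Set.image_singleton, convexHull_singleton, extremePoints_singleton,
      Set.mem_singleton_iff, Set.mem_ofPred_eq]
    constructor
    · intro h
      ext V
      exact_mod_cast congrFun h V
    · rintro rfl
      rfl
  ext ν
  simp only [minMonomials, h, Set.mem_singleton_iff, Set.mem_ofPred_eq]
  exact ⟨fun h => h.1, fun h => ⟨h, fun y hy _ => by rw [h, hy]⟩⟩

theorem support_monomial_one (μ : Mon k) :
    (MvPolynomial.monomial μ (1 : Tropical ℝ≥0∞)).support = {μ} := by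
  classical
  have h : (1 : Tropical ℝ≥0∞) ≠ 0 := Tropical.trop_injective.ne ENNReal.zero_ne_top
  rw [MvPolynomial.support_monomial, if_neg h]

theorem polyMin_monomial (μ : Mon k) :
    polyMin (MvPolynomial.monomial μ (1 : Tropical ℝ≥0∞)) = MvPolynomial.monomial μ 1 := by
  classical
  have h : ∀ ν ∈ (MvPolynomial.monomial μ (1 : Tropical ℝ≥0∞)).support, ν ∈ minMonomials
      ((MvPolynomial.monomial μ (1 : Tropical ℝ≥0∞)).support : Set (Mon k)) := by
    simp [support_monomial_one, minMonomials_singleton]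
  rw [polyMin, Finset.filter_true_of_mem h, support_monomial_one, Finset.sum_singleton]

theorem prod_map_monomial (s : Multiset (Mon k)) :
    (s.map fun μ => MvPolynomial.monomial μ (1 : Tropical ℝ≥0∞)).prod =
      MvPolynomial.monomial s.sum 1 := by
  induction s using Multiset.induction_on with
  | empty => rfl
  | cons μ s ih => simp [ih, MvPolynomial.monomial_mul]

/-- Tropical addition is a minimum, hence idempotent; this is what makes repeated typings harmless
in a merge. -/
theorem nsmul_monomial (μ : Mon k) {n : ℕ} (hn : n ≠ 0) :
    n • MvPolynomial.monomial μ (1 : Tropical ℝ≥0∞) = MvPolynomial.monomial μ 1 := by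
  induction n with
  | zero => exact absurd rfl hn
  | succ n ih =>
    rcases eq_or_ne n 0 with rfl | h
    · simp
    · rw [succ_nsmul, ih h, ← map_add, Tropical.add_self]

/-- The typing `γ ⊢^μ a`. -/
def entry (x : Pt k) : Entry k := ⟨x.1.1, MvPolynomial.monomial x.2 1, x.1.2⟩

/-- The typings of a family of labelled pairs, without repetitions. -/
def fam (K : Multiset (Pt k)) : PreJ k :=
  open Classical in K.dedup.map entry

theorem mem_fam {K : Multiset (Pt k)} {e : Entry k} : e ∈ fam K ↔ ∃ x ∈ K, entry x = e := by
  simp [fam]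

/-- Pairs that occur twice have equal labels. -/
def Functional (K : Multiset (Pt k)) : Prop := ∀ x ∈ K, ∀ y ∈ K, x.1 = y.1 → x = y

theorem Functional.nodup_dedup [DecidableEq (Pt k)] {K : Multiset (Pt k)} (h : Functional K) :
    (K.dedup.map Prod.fst).Nodup :=
  (Multiset.nodup_map_iff_of_inj_on fun x hx y hy e =>
    h x (Multiset.mem_dedup.mp hx) y (Multiset.mem_dedup.mp hy) e).mpr (Multiset.nodup_dedup K)

theorem isJudgement_fam {K : Multiset (Pt k)} (h : Functional K) : (fam K).IsJudgement := by
  classical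
  refine ⟨?_, fun e he => ?_⟩
  · rw [fam, Multiset.map_map]
    exact h.nodup_dedup
  · obtain ⟨x, -, rfl⟩ := mem_fam.mp he
    exact polyMin_monomial x.2

/-- Typings of `J` with the same pair carry the same monomial, so their sum is a positive multiple
of it, which is the monomial itself. Merging therefore only removes repetitions, and the
multiplicities in `J` do not matter. -/
theorem merge_eq_fam {J : PreJ k} {K : Multiset (Pt k)} (hK : Functional K)
    (h : ∀ e, e ∈ J ↔ ∃ x ∈ K, entry x = e) : J.merge = fam K := by
  classical
  have hkeys : (J.map Entry.key).toFinset.val = K.dedup.map Prod.fst := by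
    refine (Multiset.Nodup.ext (Finset.nodup _) hK.nodup_dedup).mpr fun p => ?_
    simp only [Finset.mem_val, Multiset.mem_toFinset, Multiset.mem_map, h, Multiset.mem_dedup]
    constructor
    · rintro ⟨_, ⟨x, hx, rfl⟩, rfl⟩
      exact ⟨x, hx, rfl⟩
    · rintro ⟨x, hx, rfl⟩
      exact ⟨_, ⟨x, hx, rfl⟩, rfl⟩
  have hsum : ∀ x ∈ K, ((J.filter fun e => e.key = x.1).map Entry.poly).sum =
      MvPolynomial.monomial x.2 1 := by
    intro x hx
    have hrep := (Multiset.eq_replicate (n := ((J.filter fun e => e.key = x.1).map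
      Entry.poly).card) (a := MvPolynomial.monomial x.2 (1 : Tropical ℝ≥0∞))).mpr ⟨rfl, by
        intro p hp
        obtain ⟨e, he, rfl⟩ := Multiset.mem_map.mp hp
        obtain ⟨he, hk⟩ := Multiset.mem_filter.mp he
        obtain ⟨y, hy, rfl⟩ := (h e).mp he
        rw [hK x hx y hy hk.symm]
        rfl⟩
    rw [hrep, Multiset.sum_replicate, nsmul_monomial]
    rw [Multiset.card_map, Ne, Multiset.card_eq_zero]
    intro h0
    have : entry x ∈ J.filter fun e => e.key = x.1 :=
      Multiset.mem_filter.mpr ⟨(h _).mpr ⟨x, hx, rfl⟩, rfl⟩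
    simp [h0] at this
  have : J.merge = (J.map Entry.key).toFinset.val.map fun p =>
      ⟨p.1, polyMin ((J.filter fun e => e.key = p).map Entry.poly).sum, p.2⟩ := by
    rw [PreJ.merge]
  rw [this, hkeys, Multiset.map_map, fam]
  refine Eq.trans (Multiset.map_congr rfl fun x hx => ?_) (by congr!)
  simp only [Function.comp_apply, hsum x (Multiset.mem_dedup.mp hx), polyMin_monomial]
  rfl

/-- The image of a functional family under a map that keeps the labels and is injective on it. -/
theorem fam_map {K : Multiset (Pt k)} (g : Pt k → Pt k)
    (hg : ∀ x ∈ K, ∀ y ∈ K, g x = g y → x = y) :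
    fam (K.map g) = (open Classical in K.dedup.map fun x => entry (g x)) := by
  classical
  have : (K.map g).dedup = K.dedup.map g := by
    refine (Multiset.Nodup.ext (Multiset.nodup_dedup _) ?_).mpr fun p => by simp
    exact (Multiset.nodup_map_iff_of_inj_on fun x hx y hy e =>
      hg x (Multiset.mem_dedup.mp hx) y (Multiset.mem_dedup.mp hy) e).mpr (Multiset.nodup_dedup K)
  have h : fam (K.map g) = (K.map g).dedup.map entry := by rw [fam]
  rw [h, this, Multiset.map_map]
  rfl

/-- The instance of application that derives a labelled pair. -/
theorem appInst_concl (p : ICtx × ITy) (γ₀ : ICtx) (ν₀ : Mon k) (K : Multiset (Pt k))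
    (t : AppInst k) (hf : t.fn = entry ((γ₀, ITy.arr (K.map fun x => x.1.2) p.2), ν₀))
    (ha : t.args = K.map entry) (hr : t.res = p.2)
    (hp : γ₀ + (K.map fun x => x.1.1).sum = p.1) :
    t.concl = entry (p, ν₀ + (K.map Prod.snd).sum) := by
  have hprod : (entry ((γ₀, ITy.arr (K.map fun x => x.1.2) p.2), ν₀)).poly ::ₘ
      (K.map entry).map Entry.poly =
      (ν₀ ::ₘ K.map Prod.snd).map fun μ => MvPolynomial.monomial μ (1 : Tropical ℝ≥0∞) := by
    simp only [Multiset.map_cons, Multiset.map_map]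
    rfl
  rw [AppInst.concl, hf, ha, hr, hprod, polyVN, prod_map_monomial, polyMin_monomial,
    Multiset.sum_cons, entry, entry, Multiset.map_map]
  exact congrArg (fun γ => Entry.mk γ _ _) hp

/-- A rigid family for an application is derived from rigid families for the function and for
the argument. -/
theorem Rigid.exists_appFamily {B : Ty} {f g : ITy → FPS k} {K : Multiset (Pt k)}
    (hK : Rigid (famSupp (FPS.app B f g)) K) :
    ∃ K₁ K₂ : Multiset (Pt k), Rigid (famSupp f) K₁ ∧ Rigid (famSupp g) K₂ ∧
      (∀ y ∈ K₁, ∃ x ∈ K, ∃ m : Multiset ITy, (∀ b ∈ m, b ∈ B.den) ∧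
        y.1.2 = ITy.arr m x.1.2 ∧ y.1.1 ≤ x.1.1) ∧
      (∀ y ∈ K₂, y.1.2 ∈ B.den ∧ ∃ x ∈ K, y.1.1 ≤ x.1.1) ∧
      ∃ L, IsAppFamily (fam K₁) (fam K₂) L ∧ PreJ.merge (L.map AppInst.concl) = fam K := by
  classical
  -- One decomposition is fixed for each labelled pair, with arbitrary values outside `K`, so
  -- repeated members of `K` yield the same instance of the rule.
  have hdec : ∀ x : Pt k, ∃ (γ₀ : ICtx) (ν₀ : Mon k) (T : Multiset (Pt k)), x ∈ K →
      (∀ y ∈ T, y.1.2 ∈ B.den) ∧ (∀ y ∈ T, y.2 ∈ famSupp g y.1) ∧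
        ν₀ ∈ famSupp f (γ₀, ITy.arr (T.map fun y => y.1.2) x.1.2) ∧
        γ₀ + (T.map fun y => y.1.1).sum = x.1.1 ∧ ν₀ + (T.map Prod.snd).sum = x.2 := by
    intro x
    by_cases hx : x ∈ K
    · obtain ⟨γ₀, ν₀, T, h⟩ := mem_famSupp_app.mp (hK.1 x hx)
      exact ⟨γ₀, ν₀, T, fun _ => h⟩
    · exact ⟨0, 0, 0, fun h => absurd h hx⟩
  choose γ₀ ν₀ T hT using hdec
  have hle : ∀ x ∈ K, ∀ y ∈ T x, y.1.1 ≤ x.1.1 := by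
    intro x hx y hy
    rw [← (hT x hx).2.2.2.1]
    exact (Multiset.le_sum_of_mem (Multiset.mem_map_of_mem (fun y : Pt k => y.1.1) hy)).trans
      le_add_self
  let fn : Pt k → Pt k := fun x => ((γ₀ x, ITy.arr ((T x).map fun y => y.1.2) x.1.2), ν₀ x)
  let inst : Pt k → AppInst k := fun x =>
    ⟨entry (fn x), (T x).map entry, x.1.2, by rw [Multiset.map_map]; rfl⟩
  have hconcl : ∀ x ∈ K, (inst x).concl = entry x := by
    intro x hx
    rw [appInst_concl x.1 (γ₀ x) (ν₀ x) (T x) (inst x) rfl rfl rfl (hT x hx).2.2.2.1,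
      (hT x hx).2.2.2.2]
  refine ⟨K.bind fun x => {fn x}, K.bind T, ?_, ?_, ?_, ?_, K.map inst, ⟨?_, ?_, ?_⟩, ?_⟩
  -- For the function, the frozen remainder of `x` is the total label of its arguments; for the
  -- arguments, below, it is the label `ν₀ x` of the function.
  · refine hK.bind _ (fun x => ((T x).map Prod.snd).sum) (fun x hx => ?_) (fun x hx => ?_)
      fun x hx s hs => ?_
    · simpa [fn] using (hT x hx).2.2.2.2
    · simpa [fn] using (hT x hx).2.2.1
    · simp only [Multiset.map_singleton, Multiset.sum_singleton] at hs
      exact mem_famSupp_app.mpr ⟨γ₀ x, s, T x, (hT x hx).1, (hT x hx).2.1, hs,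
        (hT x hx).2.2.2.1, rfl⟩
  · refine hK.bind _ ν₀ (fun x hx => ?_) (fun x hx => (hT x hx).2.1) fun x hx s hs => ?_
    · rw [add_comm, (hT x hx).2.2.2.2]
    · have hs' : s ∈ (((T x).map Prod.fst).map (famSupp g)).sum := by
        rwa [Multiset.map_map]
      obtain ⟨T', hfst, hmem, rfl⟩ := (mem_multiset_sum_map_iff _ _ _).mp hs'
      -- The relabelled arguments `T'` have the same pairs as `T x`, hence the same types and
      -- contexts: they still fit the function's typing.
      have hm : ∀ {α : Type} (F : ICtx × ITy → α),
          (T'.map fun y => F y.1) = (T x).map fun y => F y.1 := by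
        intro α F
        have := congrArg (Multiset.map F) hfst
        simpa only [Multiset.map_map, Function.comp_def] using this
      refine mem_famSupp_app.mpr ⟨γ₀ x, ν₀ x, T', ?_, hmem, ?_, ?_, add_comm _ _⟩
      · intro y hy
        have : y.1 ∈ (T x).map Prod.fst := by
          rw [← hfst]
          exact Multiset.mem_map_of_mem _ hy
        obtain ⟨z, hz, e⟩ := Multiset.mem_map.mp this
        rw [← e]
        exact (hT x hx).1 z hz
      · rw [hm Prod.snd]
        exact (hT x hx).2.2.1
      · rw [hm Prod.fst]
        exact (hT x hx).2.2.2.1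
  · intro y hy
    obtain ⟨x, hx, hy⟩ := Multiset.mem_bind.mp hy
    rw [Multiset.mem_singleton] at hy
    subst hy
    refine ⟨x, hx, (T x).map fun y => y.1.2, ?_, rfl, ?_⟩
    · intro b hb
      obtain ⟨z, hz, rfl⟩ := Multiset.mem_map.mp hb
      exact (hT x hx).1 z hz
    · rw [← (hT x hx).2.2.2.1]
      exact le_self_add
  · intro y hy
    obtain ⟨x, hx, hy⟩ := Multiset.mem_bind.mp hy
    exact ⟨(hT x hx).1 y hy, x, hx, hle x hx y hy⟩
  · intro t ht
    obtain ⟨x, hx, rfl⟩ := Multiset.mem_map.mp ht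
    refine ⟨mem_fam.mpr ⟨fn x, Multiset.mem_bind.mpr ⟨x, hx, by simp⟩, rfl⟩, fun e he => ?_⟩
    obtain ⟨y, hy, rfl⟩ := Multiset.mem_map.mp he
    exact mem_fam.mpr ⟨y, Multiset.mem_bind.mpr ⟨x, hx, hy⟩, rfl⟩
  · intro e he
    obtain ⟨y, hy, rfl⟩ := mem_fam.mp he
    obtain ⟨x, hx, hy⟩ := Multiset.mem_bind.mp hy
    rw [Multiset.mem_singleton] at hy
    exact ⟨inst x, Multiset.mem_map_of_mem _ hx, by rw [hy]⟩
  · intro e he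
    obtain ⟨y, hy, rfl⟩ := mem_fam.mp he
    obtain ⟨x, hx, hy⟩ := Multiset.mem_bind.mp hy
    exact ⟨inst x, Multiset.mem_map_of_mem _ hx, Multiset.mem_map_of_mem _ hy⟩
  · refine merge_eq_fam (fun x hx y hy => hK.eq_of_fst_eq hx hy) fun e => ?_
    simp only [Multiset.map_map, Multiset.mem_map, Function.comp_apply]
    exact exists_congr fun x => and_congr_right fun hx => by rw [hconcl x hx]

end Fam

/-! ### Supports of the interpretation -/

section SemSupp

variable {k : ℕ} {Γ : List Ty} {M N P : Term k} {A B : Ty}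

open Classical in
theorem mem_famSupp_ite_one {c a : ITy} {γ : ICtx} {μ : Mon k} :
    μ ∈ famSupp (fun a => if a = c then 1 else 0) (γ, a) ↔ a = c ∧ γ = 0 ∧ μ = 0 := by
  rw [mem_famSupp]
  by_cases h : a = c
  · simp [h, FPS.mem_supp_one, Prod.ext_iff]
  · simp [h]

theorem mem_famSupp_succ {d : Deriv Γ M .nat} {γ : ICtx} {a : ITy} {μ : Mon k} :
    μ ∈ famSupp (Deriv.succ d).sem (γ, a) ↔
      ∃ n, a = ITy.nat (n + 1) ∧ μ ∈ famSupp d.sem (γ, ITy.nat n) := by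
  simp only [mem_famSupp, Deriv.sem]
  rcases ITy.cases_form a with ⟨_ | n, rfl⟩ | ⟨m, b, rfl⟩
  · simp [ITy.nat_injective.eq_iff]
  · simp [ITy.nat_injective.eq_iff]
  · simp [(ITy.nat_ne_arr _ _ _).symm]

theorem mem_famSupp_pred {d : Deriv Γ M .nat} {γ : ICtx} {a : ITy} {μ : Mon k} :
    μ ∈ famSupp (Deriv.pred d).sem (γ, a) ↔
      ∃ n, a = ITy.nat (n - 1) ∧ μ ∈ famSupp d.sem (γ, ITy.nat n) := by
  simp only [mem_famSupp, Deriv.sem]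
  rcases ITy.cases_form a with ⟨_ | n, rfl⟩ | ⟨m, b, rfl⟩
  · simp only [ITy.dest_nat, FPS.supp_add, Set.mem_union, ITy.nat_injective.eq_iff]
    constructor
    · rintro (h | h)
      · exact ⟨0, rfl, h⟩
      · exact ⟨1, rfl, h⟩
    · rintro ⟨n, hn, h⟩
      obtain rfl | rfl : n = 0 ∨ n = 1 := by omega
      · exact Or.inl h
      · exact Or.inr h
  · simp only [ITy.dest_nat, ITy.nat_injective.eq_iff]
    constructor
    · intro h
      exact ⟨n + 2, rfl, h⟩
    · rintro ⟨n', hn, h⟩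
      obtain rfl : n' = n + 2 := by omega
      exact h
  · simp [(ITy.nat_ne_arr _ _ _).symm]

theorem mem_famSupp_cast {d : Deriv Γ M .bool} {γ : ICtx} {a : ITy} {μ : Mon k} :
    μ ∈ famSupp (Deriv.cast d).sem (γ, a) ↔ a ∈ Ty.bool.den ∧ μ ∈ famSupp d.sem (γ, a) := by
  simp only [mem_famSupp, Deriv.sem, Ty.den, Set.mem_insert_iff, Set.mem_singleton_iff]
  split_ifs with h <;> simp [h]

theorem mem_famSupp_var {x : ℕ} {h : Γ[x]? = some A} {γ : ICtx} {a : ITy} {μ : Mon k} :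
    μ ∈ famSupp (Deriv.var (k := k) x h).sem (γ, a) ↔ γ = ICtx.single x a ∧ μ = 0 := by
  simp only [mem_famSupp, Deriv.sem, FPS.mem_supp_X, ICtx.single, Prod.ext_iff]

theorem mem_famSupp_lam {d : Deriv (A :: Γ) M B} {γ : ICtx} {a : ITy} {μ : Mon k} :
    μ ∈ famSupp (Deriv.lam d).sem (γ, a) ↔
      ∃ m b, a = ITy.arr m b ∧ μ ∈ famSupp d.sem (ICtx.cons m γ, b) := by
  simp only [mem_famSupp, Deriv.sem]
  rcases ITy.cases_form a with ⟨n, rfl⟩ | ⟨m, b, rfl⟩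
  · simp [ITy.nat_ne_arr]
  · simp only [ITy.dest_arr]
    constructor
    · intro h
      exact ⟨m, b, rfl, h⟩
    · rintro ⟨m', b', e, h⟩
      obtain ⟨rfl, rfl⟩ := ITy.arr_inj e
      exact h

theorem mem_famSupp_ifz {d : Deriv Γ M .nat} {e : Deriv Γ N A} {f : Deriv Γ P A}
    {γ : ICtx} {a : ITy} {μ : Mon k} :
    μ ∈ famSupp (Deriv.ifz d e f).sem (γ, a) ↔
      ∃ γ₁ γ₂ μ₁ μ₂ n, γ₁ + γ₂ = γ ∧ μ₁ + μ₂ = μ ∧ μ₁ ∈ famSupp d.sem (γ₁, ITy.nat n) ∧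
        ((n = 0 ∧ μ₂ ∈ famSupp e.sem (γ₂, a)) ∨ (n ≠ 0 ∧ μ₂ ∈ famSupp f.sem (γ₂, a))) := by
  simp only [mem_famSupp, Deriv.sem, FPS.supp_add, FPS.supp_mul, Set.mem_union, Set.mem_add,
    FPS.mem_supp_sum, Prod.exists]
  constructor
  · rintro (⟨γ₁, μ₁, h₁, γ₂, μ₂, h₂, h⟩ | ⟨γ₁, μ₁, ⟨n, h₁⟩, γ₂, μ₂, h₂, h⟩) <;>
      obtain ⟨rfl, rfl⟩ := Prod.mk.inj h
    · exact ⟨γ₁, γ₂, μ₁, μ₂, 0, rfl, rfl, h₁, Or.inl ⟨rfl, h₂⟩⟩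
    · exact ⟨γ₁, γ₂, μ₁, μ₂, n + 1, rfl, rfl, h₁, Or.inr ⟨n.succ_ne_zero, h₂⟩⟩
  · rintro ⟨γ₁, γ₂, μ₁, μ₂, n, rfl, rfl, h₁, ⟨rfl, h₂⟩ | ⟨hn, h₂⟩⟩
    · exact Or.inl ⟨γ₁, μ₁, h₁, γ₂, μ₂, h₂, rfl⟩
    · obtain ⟨n, rfl⟩ := Nat.exists_eq_succ_of_ne_zero hn
      exact Or.inr ⟨γ₁, μ₁, ⟨n, h₁⟩, γ₂, μ₂, h₂, rfl⟩

theorem mem_famSupp_choice {i : Fin k} {d : Deriv Γ M A} {e : Deriv Γ N A}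
    {p : ICtx × ITy} {μ : Mon k} :
    μ ∈ famSupp (Deriv.choice i d e).sem p ↔
      ∃ (b : Bool) (ν : Mon k), ν + Finsupp.single (i, b) 1 = μ ∧
        ν ∈ famSupp (bif b then d.sem else e.sem) p := by
  have key : ∀ (V : Par k) (g : FPS k), (p.1, μ) ∈
      FPS.supp (MvPowerSeries.C (MvPowerSeries.X V) * g) ↔
        ∃ ν, ν + Finsupp.single V 1 = μ ∧ (p.1, ν) ∈ g.supp := by
    intro V g
    simp only [FPS.supp_mul, Set.mem_add, FPS.mem_supp_C_X, exists_eq_left, Prod.exists,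
      Prod.mk_add_mk, zero_add, Prod.mk.injEq]
    constructor
    · rintro ⟨γ, ν, h, rfl, rfl⟩
      exact ⟨ν, add_comm _ _, h⟩
    · rintro ⟨ν, rfl, h⟩
      exact ⟨_, ν, h, rfl, add_comm _ _⟩
  simp only [mem_famSupp, Deriv.sem, FPS.supp_add, Set.mem_union, key, Bool.exists_bool, cond_true,
    cond_false]
  exact Or.comm

theorem mem_famSupp_fix {d : Deriv Γ M (.arr A A)} {p : ICtx × ITy} {μ : Mon k} :
    μ ∈ famSupp (Deriv.fix d).sem p ↔ ∃ n, μ ∈ famSupp (FPS.approx A d.sem n) p := by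
  simp only [mem_famSupp, Deriv.sem, FPS.mem_supp_sup]

end SemSupp

/-! ### Contexts -/

@[simp] theorem ICtx.cons_zero [DecidableEq ITy] (m : Multiset ITy) (γ : ICtx) (a : ITy) :
    ICtx.cons m γ (0, a) = m.count a := by
  have h₁ := Finsupp.mapDomain_apply (f := fun a : ITy => ((0 : ℕ), a))
    (fun _ _ h => (Prod.mk.inj h).2) (Multiset.toFinsupp m) a
  have h₂ : (γ.mapDomain fun p : ℕ × ITy => (p.1 + 1, p.2)) (0, a) = 0 :=
    Finsupp.mapDomain_of_notMem_range _ _ (by rintro ⟨p, hp⟩; simp at hp)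
  have h : ICtx.cons m γ = (Multiset.toFinsupp m).mapDomain (fun a => ((0 : ℕ), a)) +
    γ.mapDomain (fun p => (p.1 + 1, p.2)) := by
    rw [ICtx.cons]
    congr!
  rw [h, Finsupp.add_apply, h₁, h₂, add_zero, Multiset.toFinsupp_apply]

@[simp] theorem ICtx.cons_succ (m : Multiset ITy) (γ : ICtx) (x : ℕ) (a : ITy) :
    ICtx.cons m γ (x + 1, a) = γ (x, a) := by
  classical
  rw [ICtx.cons, Finsupp.add_apply, Finsupp.mapDomain_of_notMem_range _ _ (by rintro ⟨p, hp⟩; simp at hp),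
    zero_add]
  exact Finsupp.mapDomain_apply (f := fun p : ℕ × ITy => (p.1 + 1, p.2))
    (fun p q h => by
      obtain ⟨h₁, h₂⟩ := Prod.mk.inj h
      exact Prod.ext (Nat.succ_injective h₁) h₂) γ (x, a)

theorem ICtx.cons_inj {m m' : Multiset ITy} {γ γ' : ICtx} (h : ICtx.cons m γ = ICtx.cons m' γ') :
    m = m' ∧ γ = γ' := by
  classical
  refine ⟨Multiset.ext.mpr fun a => ?_, Finsupp.ext fun ⟨x, a⟩ => ?_⟩
  · simpa using DFunLike.congr_fun h (0, a)
  · simpa using DFunLike.congr_fun h (x + 1, a)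

/-- The context of a typing is split among the subterms, so each of them receives a smaller one. -/
theorem Adequate.anti {Γ : List Ty} {A B : Ty} {γ γ' : ICtx} {a b : ITy} (h : Adequate Γ A γ a)
    (hγ : γ' ≤ γ) (hb : b ∈ B.den) : Adequate Γ B γ' b :=
  ⟨hb, fun x c hc => h.2 x c fun h0 => hc (Nat.le_zero.mp (h0 ▸ hγ (x, c)))⟩

theorem adequate_cons {Γ : List Ty} {A B : Ty} {γ : ICtx} {m : Multiset ITy} {b : ITy} :
    Adequate (A :: Γ) B (ICtx.cons m γ) b ↔ Adequate Γ (.arr A B) γ (ITy.arr m b) := by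
  classical
  constructor
  · rintro ⟨hb, h⟩
    refine ⟨⟨m, b, rfl, fun a ha => ?_, hb⟩, fun x c hc => ?_⟩
    · obtain ⟨B', hB, ha⟩ := h 0 a (by simpa using ha)
      simp only [List.getElem?_cons_zero, Option.some.injEq] at hB
      exact hB ▸ ha
    · simpa using h (x + 1) c (by simpa using hc)
  · rintro ⟨⟨m', b', e, hm, hb⟩, h⟩
    obtain ⟨rfl, rfl⟩ := ITy.arr_inj e
    refine ⟨hb, fun x c hc => ?_⟩
    cases x with
    | zero => exact ⟨A, rfl, hm c (by simpa using hc)⟩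
    | succ x => simpa using h x c (by simpa using hc)

/-! ### Completeness for rigid families -/

theorem lookup_trans {Γ Δ Θ : List Ty} (h : ∀ (x : ℕ) (A : Ty), Γ[x]? = some A → Δ[x]? = some A)
    (h' : ∀ (x : ℕ) (A : Ty), Δ[x]? = some A → Θ[x]? = some A) :
    ∀ (x : ℕ) (A : Ty), Γ[x]? = some A → Θ[x]? = some A :=
  fun x A hx => h' x A (h x A hx)

section Complete

variable {k : ℕ}

theorem Deriv.weaken_weaken {Γ : List Ty} {M : Term k} {A : Ty} (d : Deriv Γ M A) :
    ∀ {Δ Θ : List Ty} (h : ∀ (x : ℕ) (A : Ty), Γ[x]? = some A → Δ[x]? = some A)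
      (h' : ∀ (x : ℕ) (A : Ty), Δ[x]? = some A → Θ[x]? = some A),
      (d.weaken h).weaken h' = d.weaken (lookup_trans h h') := by
  induction d <;> intros <;> simp_all [Deriv.weaken]

/-- Some derivation in the intersection type system refines `d` and has the conclusion `J`. -/
def Derivable {Γ : List Ty} {M : Term k} {A : Ty} (J : PreJ k) (d : Deriv Γ M A) : Prop :=
  ∃ π : IDeriv M J, Refines π d

theorem derivable_empty {Γ : List Ty} {M : Term k} {A : Ty} (d : Deriv Γ M A) : Derivable 0 d :=
  ⟨.empty M, .empty d⟩

theorem fam_eq_zero_or_singleton {K : Multiset (Pt k)} {x : Pt k} (h : ∀ y ∈ K, y = x) :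
    fam K = 0 ∨ fam K = {entry x} := by
  classical
  rcases Multiset.empty_or_exists_mem K with rfl | ⟨y, hy⟩
  · exact Or.inl rfl
  · right
    have : K.dedup = {x} := by
      refine (Multiset.Nodup.ext (Multiset.nodup_dedup K) (Multiset.nodup_singleton x)).mpr
        fun z => ?_
      rw [Multiset.mem_dedup, Multiset.mem_singleton]
      exact ⟨h z, fun e => e ▸ h y hy ▸ hy⟩
    have h' : fam K = K.dedup.map entry := by rw [fam]
    rw [h', this, Multiset.map_singleton]

/-- A constant has a single labelled pair, so up to repetitions the family is that pair or empty;
the rule for the empty family covers the latter. -/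
theorem derivable_fam_num {Γ : List Ty} {M : Term k} {A : Ty} {d : Deriv Γ M A} {n : ℕ}
    {K : Multiset (Pt k)} (hd : Derivable {⟨0, 1, ITy.nat n⟩} d)
    (h : ∀ x ∈ K, x.1.2 = ITy.nat n ∧ x.1.1 = 0 ∧ x.2 = 0) : Derivable (fam K) d := by
  rcases fam_eq_zero_or_singleton (K := K) (x := ((0, ITy.nat n), 0)) fun y hy =>
    Prod.ext (Prod.ext (h y hy).2.1 (h y hy).1) (h y hy).2.2 with e | e
  · rw [e]
    exact derivable_empty d
  · rw [e]
    exact hd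

theorem Rigid.functional {S : ICtx × ITy → Set (Mon k)} {K : Multiset (Pt k)} (h : Rigid S K) :
    Functional K := fun _ hx _ hy => h.eq_of_fst_eq hx hy

/-- Rigidity for a family obtained from some members of a rigid family. -/
theorem Rigid.bind_ite {S S' : ICtx × ITy → Set (Mon k)} {K : Multiset (Pt k)} (h : Rigid S K)
    (p : Pt k → Prop) [DecidablePred p] (g : Pt k → Pt k) (c : Pt k → Mon k)
    (hg : ∀ x ∈ K, p x → (g x).2 + c x = x.2 ∧ (g x).2 ∈ S' (g x).1 ∧
      ∀ s ∈ S' (g x).1, s + c x ∈ S x.1) :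
    Rigid S' (K.bind fun x => if p x then {g x} else 0) := by
  -- A member that is left out produces no piece, so its entire label is frozen.
  refine h.bind _ (fun x => if p x then c x else x.2) (fun x hx => ?_) (fun x hx => ?_)
    fun x hx s hs => ?_
  · by_cases hp : p x
    · simpa [hp] using (hg x hx hp).1
    · simp [hp]
  · by_cases hp : p x
    · simpa [hp] using (hg x hx hp).2.1
    · simp [hp]
  · by_cases hp : p x
    · simp only [if_pos hp, Multiset.map_singleton, Multiset.sum_singleton] at hs ⊢
      exact (hg x hx hp).2.2 s hs
    · simp only [if_neg hp, Multiset.map_zero, Multiset.sum_zero, Set.mem_zero] at hs ⊢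
      rw [hs, zero_add]
      exact h.1 x hx

theorem mem_bind_ite {K : Multiset (Pt k)} {p : Pt k → Prop} [DecidablePred p] {g : Pt k → Pt k}
    {y : Pt k} : (y ∈ K.bind fun x => if p x then {g x} else 0) ↔ ∃ x ∈ K, p x ∧ y = g x := by
  rw [Multiset.mem_bind]
  refine exists_congr fun x => and_congr_right fun _ => ?_
  split_ifs with h <;> simp [h]

theorem entry_scale (x : Pt k) (V : Par k) :
    (⟨(entry x).ctx, (entry x).poly * MvPolynomial.X V, (entry x).ty⟩ : Entry k) =
      entry (x.1, x.2 + Finsupp.single V 1) := by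
  simp only [entry, MvPolynomial.X, MvPolynomial.monomial_mul, mul_one]

theorem ifzConcl_entry (x y : Pt k) :
    ifzConcl (entry x, entry y) = entry ((x.1.1 + y.1.1, y.1.2), x.2 + y.2) := by
  have h := prod_map_monomial (k := k) {x.2, y.2}
  simp only [Multiset.insert_eq_cons, Multiset.map_cons, Multiset.map_singleton,
    Multiset.sum_cons, Multiset.sum_singleton] at h
  simp only [ifzConcl, entry, polyVN, Multiset.insert_eq_cons, h, polyMin_monomial]

/-- Completeness for rigid families, for all weakenings of a typing derivation. -/
def CompleteFor {Γ : List Ty} {M : Term k} {A : Ty} (d : Deriv Γ M A) : Prop :=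
  ∀ K : Multiset (Pt k), Rigid (famSupp d.sem) K → (∀ x ∈ K, Adequate Γ A x.1.1 x.1.2) →
    ∀ (Δ : List Ty) (h : ∀ (x : ℕ) (A : Ty), Γ[x]? = some A → Δ[x]? = some A),
      Derivable (fam K) (d.weaken h)

/-! ### Completeness for each typing rule -/

variable {Γ : List Ty} {M N P : Term k} {A B : Ty}

theorem CompleteFor.succ {d : Deriv Γ M .nat} (hd : CompleteFor d) :
    CompleteFor (Deriv.succ d) := by
  classical
  intro K hK hA Δ h
  have hdec : ∀ x : Pt k, ∃ n, x ∈ K →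
      x.1.2 = ITy.nat (n + 1) ∧ x.2 ∈ famSupp d.sem (x.1.1, ITy.nat n) := by
    intro x
    by_cases hx : x ∈ K
    · obtain ⟨n, hn⟩ := mem_famSupp_succ.mp (hK.1 x hx)
      exact ⟨n, fun _ => hn⟩
    · exact ⟨0, fun h => absurd h hx⟩
  choose n hn using hdec
  have hK' : Rigid (famSupp d.sem) (K.map fun x => ((x.1.1, ITy.nat (n x)), x.2)) :=
    hK.map (fun x => (x.1.1, ITy.nat (n x))) (fun x hx => (hn x hx).2) fun x hx s hs =>
      mem_famSupp_succ.mpr ⟨n x, (hn x hx).1, hs⟩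
  obtain ⟨π, hπ⟩ : Derivable ((K.dedup.map fun x => (x.1.1, (entry x).poly, n x)).map
      fun p => ⟨p.1, p.2.1, ITy.nat p.2.2⟩) (d.weaken h) := by
    have := hd _ hK' (by
      intro y hy
      obtain ⟨x, hx, rfl⟩ := Multiset.mem_map.mp hy
      exact (hA x hx).anti le_rfl ⟨n x, rfl⟩) Δ h
    -- The map is injective on `K`, since `n x` determines the type of `x`; premise and conclusion
    -- can thus be indexed by the same `K.dedup`.
    rw [fam_map (fun x => ((x.1.1, ITy.nat (n x)), x.2))] at this
    · rw [Multiset.map_map]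
      exact this
    · intro x hx y hy e
      simp only [Prod.mk.injEq, ITy.nat_injective.eq_iff] at e
      exact Prod.ext (Prod.ext e.1.1 (by rw [(hn x hx).1, (hn y hy).1, e.1.2])) e.2
  have e : fam K = (K.dedup.map fun x => (x.1.1, (entry x).poly, n x)).map
      fun p => ⟨p.1, p.2.1, ITy.nat (p.2.2 + 1)⟩ := by
    rw [Multiset.map_map]
    refine Multiset.map_congr (by congr!) fun x hx => ?_
    simp only [Function.comp_apply, ← (hn x (Multiset.mem_dedup.mp hx)).1]
    rfl
  rw [e]
  exact ⟨.succ _ π, .succ hπ⟩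

theorem CompleteFor.pred {d : Deriv Γ M .nat} (hd : CompleteFor d) :
    CompleteFor (Deriv.pred d) := by
  classical
  intro K hK hA Δ h
  have hdec : ∀ x : Pt k, ∃ n, x ∈ K →
      x.1.2 = ITy.nat (n - 1) ∧ x.2 ∈ famSupp d.sem (x.1.1, ITy.nat n) := by
    intro x
    by_cases hx : x ∈ K
    · obtain ⟨n, hn⟩ := mem_famSupp_pred.mp (hK.1 x hx)
      exact ⟨n, fun _ => hn⟩
    · exact ⟨0, fun h => absurd h hx⟩
  choose n hn using hdec
  have hK' : Rigid (famSupp d.sem) (K.map fun x => ((x.1.1, ITy.nat (n x)), x.2)) :=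
    hK.map (fun x => (x.1.1, ITy.nat (n x))) (fun x hx => (hn x hx).2) fun x hx s hs =>
      mem_famSupp_pred.mpr ⟨n x, (hn x hx).1, hs⟩
  obtain ⟨π, hπ⟩ : Derivable ((K.dedup.map fun x => (x.1.1, (entry x).poly, n x)).map
      fun p => ⟨p.1, p.2.1, ITy.nat p.2.2⟩) (d.weaken h) := by
    have := hd _ hK' (by
      intro y hy
      obtain ⟨x, hx, rfl⟩ := Multiset.mem_map.mp hy
      exact (hA x hx).anti le_rfl ⟨n x, rfl⟩) Δ h
    rw [fam_map (fun x => ((x.1.1, ITy.nat (n x)), x.2))] at this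
    · rw [Multiset.map_map]
      exact this
    · intro x hx y hy e
      simp only [Prod.mk.injEq, ITy.nat_injective.eq_iff] at e
      exact Prod.ext (Prod.ext e.1.1 (by rw [(hn x hx).1, (hn y hy).1, e.1.2])) e.2
  have e : fam K = (K.dedup.map fun x => (x.1.1, (entry x).poly, n x)).map
      fun p => ⟨p.1, p.2.1, ITy.nat (p.2.2 - 1)⟩ := by
    rw [Multiset.map_map]
    refine Multiset.map_congr (by congr!) fun x hx => ?_
    simp only [Function.comp_apply, ← (hn x (Multiset.mem_dedup.mp hx)).1]
    rfl
  rw [e]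
  -- Truncation identifies the predecessors of `0` and `1`, so distinct pairs in the premise could
  -- collide. Rigidity of `K` itself ensures that the conclusion is a judgement.
  exact ⟨.pred _ (e ▸ isJudgement_fam hK.functional) π, .pred hπ⟩

theorem CompleteFor.lam {d : Deriv (A :: Γ) M B} (hd : CompleteFor d) :
    CompleteFor (Deriv.lam d) := by
  classical
  intro K hK hA Δ h
  have hdec : ∀ x : Pt k, ∃ (m : Multiset ITy) (b : ITy), x ∈ K →
      x.1.2 = ITy.arr m b ∧ x.2 ∈ famSupp d.sem (ICtx.cons m x.1.1, b) := by
    intro x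
    by_cases hx : x ∈ K
    · obtain ⟨m, b, hn⟩ := mem_famSupp_lam.mp (hK.1 x hx)
      exact ⟨m, b, fun _ => hn⟩
    · exact ⟨0, ITy.nat 0, fun h => absurd h hx⟩
  choose m b hn using hdec
  have hK' : Rigid (famSupp d.sem) (K.map fun x => ((ICtx.cons (m x) x.1.1, b x), x.2)) :=
    hK.map (fun x => (ICtx.cons (m x) x.1.1, b x)) (fun x hx => (hn x hx).2) fun x hx s hs =>
      mem_famSupp_lam.mpr ⟨m x, b x, (hn x hx).1, hs⟩
  obtain ⟨π, hπ⟩ : Derivable ((K.dedup.map fun x => (x.1.1, m x, (entry x).poly, b x)).map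
      fun p => ⟨ICtx.cons p.2.1 p.1, p.2.2.1, p.2.2.2⟩) (d.weaken (lookup_cons h A)) := by
    have := hd _ hK' (by
      intro y hy
      obtain ⟨x, hx, rfl⟩ := Multiset.mem_map.mp hy
      refine adequate_cons.mpr ?_
      rw [← (hn x hx).1]
      exact hA x hx) _ (lookup_cons h A)
    rw [fam_map (fun x => ((ICtx.cons (m x) x.1.1, b x), x.2))] at this
    · rw [Multiset.map_map]
      exact this
    · intro x hx y hy e
      simp only [Prod.mk.injEq] at e
      obtain ⟨e₁, e₂⟩ := ICtx.cons_inj e.1.1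
      exact Prod.ext (Prod.ext e₂ (by rw [(hn x hx).1, (hn y hy).1, e.1.2, e₁])) e.2
  have e : fam K = (K.dedup.map fun x => (x.1.1, m x, (entry x).poly, b x)).map
      fun p => ⟨p.1, p.2.2.1, ITy.arr p.2.1 p.2.2.2⟩ := by
    rw [Multiset.map_map]
    refine Multiset.map_congr (by congr!) fun x hx => ?_
    simp only [Function.comp_apply, ← (hn x (Multiset.mem_dedup.mp hx)).1]
    rfl
  rw [e]
  exact ⟨.lam _ π, .lam hπ⟩

theorem CompleteFor.var (x : ℕ) (hx : Γ[x]? = some A) :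
    CompleteFor (Deriv.var (k := k) x hx) := by
  classical
  intro K hK hA Δ h
  have hn : ∀ y ∈ K, y.1.1 = ICtx.single x y.1.2 ∧ y.2 = 0 :=
    fun y hy => mem_famSupp_var.mp (hK.1 y hy)
  have e : fam K = ((K.map fun y => y.1.2).toFinset.val.map
      fun a => ⟨ICtx.single x a, 1, a⟩) := by
    -- For a variable, the type alone determines the context and the label, so the family amounts to
    -- a set of types.
    have : (K.map fun y => y.1.2).toFinset.val = K.dedup.map fun y => y.1.2 := by
      refine (Multiset.Nodup.ext (Finset.nodup _) ?_).mpr fun a => by simp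
      refine (Multiset.nodup_map_iff_of_inj_on fun y hy z hz e => ?_).mpr (Multiset.nodup_dedup K)
      have hy' := hn y (Multiset.mem_dedup.mp hy)
      have hz' := hn z (Multiset.mem_dedup.mp hz)
      exact Prod.ext (Prod.ext (by rw [hy'.1, hz'.1, e]) e) (by rw [hy'.2, hz'.2])
    rw [this, Multiset.map_map]
    refine Multiset.map_congr (by congr!) fun y hy => ?_
    have hy' := hn y (Multiset.mem_dedup.mp hy)
    rw [Function.comp_apply, ← hy'.1, entry, hy'.2]
    rfl
  rw [e]
  refine ⟨.var x _, .var x (h x A hx) _ fun a ha => ?_⟩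
  obtain ⟨y, hy, rfl⟩ := Multiset.mem_map.mp (Multiset.mem_toFinset.mp ha)
  exact (hA y hy).1

theorem CompleteFor.cast {d : Deriv Γ M .bool} (hd : CompleteFor d) :
    CompleteFor (Deriv.cast d) := by
  intro K hK hA Δ h
  have hn : ∀ y ∈ K, y.1.2 ∈ Ty.bool.den ∧ y.2 ∈ famSupp d.sem y.1 :=
    fun y hy => mem_famSupp_cast.mp (hK.1 y hy)
  obtain ⟨π, hπ⟩ := hd K (by
    have := hK.map (S' := famSupp d.sem) Prod.fst (fun y hy => (hn y hy).2) fun y hy s hs =>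
      mem_famSupp_cast.mpr ⟨(hn y hy).1, hs⟩
    simpa using this) (fun y hy => (hA y hy).anti le_rfl (hn y hy).1) Δ h
  exact ⟨π, .cast hπ⟩

theorem CompleteFor.choice (i : Fin k) {d : Deriv Γ M A} {e : Deriv Γ N A} (hd : CompleteFor d)
    (he : CompleteFor e) : CompleteFor (Deriv.choice i d e) := by
  classical
  intro K hK hA Δ h
  have hdec : ∀ x : Pt k, ∃ (b : Bool) (ν : Mon k), x ∈ K →
      ν + Finsupp.single (i, b) 1 = x.2 ∧ ν ∈ famSupp (bif b then d.sem else e.sem) x.1 := by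
    intro x
    by_cases hx : x ∈ K
    · obtain ⟨b, ν, hn⟩ := mem_famSupp_choice.mp (hK.1 x hx)
      exact ⟨b, ν, fun _ => hn⟩
    · exact ⟨true, 0, fun h => absurd h hx⟩
  choose b ν hn using hdec
  -- The family is divided according to the branch that produces each member; in each part the
  -- parameter of the choice is the remainder.
  have hrigid : ∀ b' : Bool, Rigid (famSupp (bif b' then d.sem else e.sem))
      (K.bind fun x => if b x = b' then {(x.1, ν x)} else 0) := by
    intro b'
    refine hK.bind_ite _ _ (fun _ => Finsupp.single (i, b') 1) fun x hx hb => ?_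
    obtain ⟨h₁, h₂⟩ := hn x hx
    rw [hb] at h₁ h₂
    exact ⟨h₁, h₂, fun s hs => mem_famSupp_choice.mpr ⟨b', s, rfl, hs⟩⟩
  have hadq : ∀ b' : Bool, ∀ y ∈ (K.bind fun x => if b x = b' then {(x.1, ν x)} else 0),
      Adequate Γ A y.1.1 y.1.2 := by
    intro b' y hy
    obtain ⟨x, hx, -, rfl⟩ := mem_bind_ite.mp hy
    exact hA x hx
  obtain ⟨π, hπ⟩ := hd _ (hrigid true) (hadq true) Δ h
  obtain ⟨ρ, hρ⟩ := he _ (hrigid false) (hadq false) Δ h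
  rw [← merge_eq_fam hK.functional (J :=
    (fam (K.bind fun x => if b x = true then {(x.1, ν x)} else 0)).scale (i, true) +
      (fam (K.bind fun x => if b x = false then {(x.1, ν x)} else 0)).scale (i, false)) ?_]
  · exact ⟨.choice i π ρ, .choice i hπ hρ⟩
  · have hmem : ∀ (b' : Bool) (t : Entry k),
        t ∈ (fam (K.bind fun x => if b x = b' then {(x.1, ν x)} else 0)).scale (i, b') ↔
          ∃ x ∈ K, b x = b' ∧ entry x = t := by
      intro b' t
      simp only [PreJ.scale, Multiset.mem_map, mem_fam]
      constructor
      · rintro ⟨_, ⟨y, hy, rfl⟩, rfl⟩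
        obtain ⟨x, hx, hb, rfl⟩ := mem_bind_ite.mp hy
        refine ⟨x, hx, hb, ?_⟩
        rw [entry_scale, ← hb, (hn x hx).1]
      · rintro ⟨x, hx, hb, rfl⟩
        refine ⟨_, ⟨_, mem_bind_ite.mpr ⟨x, hx, hb, rfl⟩, rfl⟩, ?_⟩
        rw [entry_scale, ← hb, (hn x hx).1]
    intro t
    rw [Multiset.mem_add, hmem, hmem]
    constructor
    · rintro (⟨x, hx, -, ht⟩ | ⟨x, hx, -, ht⟩) <;> exact ⟨x, hx, ht⟩
    · rintro ⟨x, hx, ht⟩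
      cases hb : b x
      · exact Or.inr ⟨x, hx, hb, ht⟩
      · exact Or.inl ⟨x, hx, hb, ht⟩

theorem CompleteFor.ifz {d : Deriv Γ M .nat} {e : Deriv Γ N A} {f : Deriv Γ P A}
    (hd : CompleteFor d) (he : CompleteFor e) (hf : CompleteFor f) :
    CompleteFor (Deriv.ifz d e f) := by
  classical
  intro K hK hA Δ h
  have hdec : ∀ x : Pt k, ∃ (γ₁ γ₂ : ICtx) (μ₁ μ₂ : Mon k) (n : ℕ), x ∈ K →
      γ₁ + γ₂ = x.1.1 ∧ μ₁ + μ₂ = x.2 ∧ μ₁ ∈ famSupp d.sem (γ₁, ITy.nat n) ∧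
        ((n = 0 ∧ μ₂ ∈ famSupp e.sem (γ₂, x.1.2)) ∨
          (n ≠ 0 ∧ μ₂ ∈ famSupp f.sem (γ₂, x.1.2))) := by
    intro x
    by_cases hx : x ∈ K
    · obtain ⟨γ₁, γ₂, μ₁, μ₂, n, hn⟩ := mem_famSupp_ifz.mp (hK.1 x hx)
      exact ⟨γ₁, γ₂, μ₁, μ₂, n, fun _ => hn⟩
    · exact ⟨0, 0, 0, 0, 0, fun h => absurd h hx⟩
  choose γ₁ γ₂ μ₁ μ₂ n hn using hdec
  let g₁ : Pt k → Pt k := fun x => ((γ₁ x, ITy.nat (n x)), μ₁ x)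
  let g₂ : Pt k → Pt k := fun x => ((γ₂ x, x.1.2), μ₂ x)
  have hle : ∀ x ∈ K, γ₁ x ≤ x.1.1 ∧ γ₂ x ≤ x.1.1 := by
    intro x hx
    rw [← (hn x hx).1]
    exact ⟨le_self_add, le_add_self⟩
  have hadq : ∀ x ∈ K, Adequate Γ A (γ₂ x) x.1.2 := fun x hx =>
    (hA x hx).anti (hle x hx).2 (hA x hx).1
  -- Every member uses the guard; the trivial condition allows `Rigid.bind_ite` to serve for the
  -- guard and for both branches.
  obtain ⟨π, hπ⟩ := hd (K.bind fun x => if True then {g₁ x} else 0)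
    (hK.bind_ite _ _ μ₂ fun x hx _ => ⟨(hn x hx).2.1, (hn x hx).2.2.1, fun s hs =>
      mem_famSupp_ifz.mpr ⟨γ₁ x, γ₂ x, s, μ₂ x, n x, (hn x hx).1, rfl, hs, (hn x hx).2.2.2⟩⟩)
    (by
      intro y hy
      obtain ⟨x, hx, -, rfl⟩ := mem_bind_ite.mp hy
      exact (hA x hx).anti (hle x hx).1 ⟨n x, rfl⟩) Δ h
  obtain ⟨ρ, hρ⟩ := he (K.bind fun x => if n x = 0 then {g₂ x} else 0)
    (hK.bind_ite _ _ μ₁ fun x hx h0 => by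
      obtain ⟨h₁, h₂, h₃, h₄⟩ := hn x hx
      refine ⟨by rw [← h₂, add_comm], (h₄.resolve_right fun h => h.1 h0).2, fun s hs => ?_⟩
      exact mem_famSupp_ifz.mpr ⟨γ₁ x, γ₂ x, μ₁ x, s, n x, h₁, add_comm _ _, h₃,
        Or.inl ⟨h0, hs⟩⟩)
    (by
      intro y hy
      obtain ⟨x, hx, -, rfl⟩ := mem_bind_ite.mp hy
      exact hadq x hx) Δ h
  obtain ⟨σ, hσ⟩ := hf (K.bind fun x => if n x ≠ 0 then {g₂ x} else 0)
    (hK.bind_ite _ _ μ₁ fun x hx h0 => by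
      obtain ⟨h₁, h₂, h₃, h₄⟩ := hn x hx
      refine ⟨by rw [← h₂, add_comm], (h₄.resolve_left fun h => h0 h.1).2, fun s hs => ?_⟩
      exact mem_famSupp_ifz.mpr ⟨γ₁ x, γ₂ x, μ₁ x, s, n x, h₁, add_comm _ _, h₃,
        Or.inr ⟨h0, hs⟩⟩)
    (by
      intro y hy
      obtain ⟨x, hx, -, rfl⟩ := mem_bind_ite.mp hy
      exact hadq x hx) Δ h
  have hconcl : ∀ x ∈ K, ifzConcl (entry (g₁ x), entry (g₂ x)) = entry x := by
    intro x hx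
    rw [ifzConcl_entry, (hn x hx).2.1, (hn x hx).1]
  rw [← merge_eq_fam hK.functional
    (J := (K.map fun x => (entry (g₁ x), entry (g₂ x))).map ifzConcl) ?_]
  · refine ⟨.ifz _ ?_ ?_ π ρ σ, .ifz hπ hρ hσ⟩
    · intro t ht
      obtain ⟨y, hy, rfl⟩ := mem_fam.mp ht
      obtain ⟨x, hx, -, rfl⟩ := mem_bind_ite.mp hy
      exact ⟨n x, rfl⟩
    · intro q hq
      obtain ⟨x, hx, rfl⟩ := Multiset.mem_map.mp hq
      refine ⟨mem_fam.mpr ⟨g₁ x, mem_bind_ite.mpr ⟨x, hx, trivial, rfl⟩, rfl⟩, ?_⟩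
      by_cases h0 : n x = 0
      · refine Or.inl ⟨?_, mem_fam.mpr ⟨g₂ x, mem_bind_ite.mpr ⟨x, hx, h0, rfl⟩, rfl⟩⟩
        rw [← h0]
        rfl
      · refine Or.inr ⟨⟨n x - 1, ?_⟩, mem_fam.mpr ⟨g₂ x, mem_bind_ite.mpr ⟨x, hx, h0, rfl⟩, rfl⟩⟩
        rw [Nat.sub_add_cancel (Nat.pos_of_ne_zero h0)]
        rfl
  · intro t
    simp only [Multiset.map_map, Multiset.mem_map, Function.comp_apply]
    exact exists_congr fun x => and_congr_right fun hx => by rw [hconcl x hx]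

theorem CompleteFor.app {d : Deriv Γ M (.arr A B)} {e : Deriv Γ N A} (hd : CompleteFor d)
    (he : CompleteFor e) : CompleteFor (Deriv.app d e) := by
  intro K hK hA Δ h
  obtain ⟨K₁, K₂, h₁, h₂, hA₁, hA₂, L, hL, hm⟩ :=
    Rigid.exists_appFamily (B := A) (f := d.sem) (g := e.sem) hK
  obtain ⟨π, hπ⟩ := hd K₁ h₁ (by
    intro y hy
    obtain ⟨x, hx, m, hm, e, hle⟩ := hA₁ y hy
    exact (hA x hx).anti hle ⟨m, x.1.2, e, hm, (hA x hx).1⟩) Δ h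
  obtain ⟨ρ, hρ⟩ := he K₂ h₂ (by
    intro y hy
    obtain ⟨hB, x, hx, hle⟩ := hA₂ y hy
    exact (hA x hx).anti hle hB) Δ h
  rw [← hm]
  exact ⟨.app L hL π ρ, .app hπ hρ⟩

/-- Stage `0` has empty support, so only the empty family occurs, and an empty cluster derives it.
Stage `n + 1` applies `M` to stage `n`, which adds one fixpoint rule to the cluster and one
application to its unfolding. -/
theorem CompleteFor.approx {d : Deriv Γ M (.arr A A)} (hd : CompleteFor d) (n : ℕ) :
    ∀ K : Multiset (Pt k), Rigid (famSupp (FPS.approx A d.sem n)) K →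
      (∀ x ∈ K, Adequate Γ A x.1.1 x.1.2) →
      ∀ (Δ : List Ty) (h : ∀ (x : ℕ) (A : Ty), Γ[x]? = some A → Δ[x]? = some A),
        ∃ π : IDeriv (.fix M) (fam K),
          Refines (π.unfold Δ.length) ((d.weaken h).unfold π.cluster) := by
  induction n with
  | zero =>
    intro K hK hA Δ h
    have h0 : K = 0 := by
      refine Multiset.eq_zero_of_forall_notMem fun x hx => ?_
      have := hK.1 x hx
      simp [mem_famSupp, FPS.approx] at this
    subst h0
    exact ⟨.empty _, .empty _⟩
  | succ n ih =>
    intro K hK hA Δ h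
    obtain ⟨K₁, K₂, h₁, h₂, hA₁, hA₂, L, hL, hm⟩ :=
      Rigid.exists_appFamily (B := A) (f := d.sem) (g := FPS.approx A d.sem n) hK
    -- The unfolding types `M` in `Δ` extended with the fresh variable. This is why `CompleteFor`
    -- quantifies over all weakenings.
    obtain ⟨π, hπ⟩ := hd K₁ h₁ (by
      intro y hy
      obtain ⟨x, hx, m, hm, e, hle⟩ := hA₁ y hy
      exact (hA x hx).anti hle ⟨m, x.1.2, e, hm, (hA x hx).1⟩) _
        (lookup_trans h (lookup_append [A]))
    rw [← Deriv.weaken_weaken d h (lookup_append [A])] at hπ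
    obtain ⟨ρ, hρ⟩ := ih K₂ h₂ (by
      intro y hy
      obtain ⟨hB, x, hx, hle⟩ := hA₂ y hy
      exact (hA x hx).anti hle hB) Δ h
    rw [← hm]
    exact ⟨.fix L hL π ρ, .app hπ hρ⟩

theorem CompleteFor.fix {d : Deriv Γ M (.arr A A)} (hd : CompleteFor d) :
    CompleteFor (Deriv.fix d) := by
  classical
  intro K hK hA Δ h
  have hdec : ∀ x : Pt k, ∃ n, x ∈ K → x.2 ∈ famSupp (FPS.approx A d.sem n) x.1 := by
    intro x
    by_cases hx : x ∈ K
    · obtain ⟨n, hn⟩ := mem_famSupp_fix.mp (hK.1 x hx)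
      exact ⟨n, fun _ => hn⟩
    · exact ⟨0, fun h => absurd h hx⟩
  choose n hn using hdec
  -- The largest stage needed in `K` serves all members. Its supports lie inside those of the
  -- fixpoint, so rigidity is inherited.
  obtain ⟨π, hπ⟩ := hd.approx (K.toFinset.sup n) K
    (hK.mono (fun p μ hμ => mem_famSupp_fix.mpr ⟨_, hμ⟩) fun x hx =>
      famSupp_approx_mono A d.sem (Finset.le_sup (Multiset.mem_toFinset.mpr hx)) _ (hn x hx))
    hA Δ h
  exact ⟨π, .fix hπ⟩

theorem completeFor (d : Deriv Γ M A) : CompleteFor d := by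
  induction d with
  | zeroNat =>
    exact fun K hK hA Δ h => derivable_fam_num ⟨_, .zeroNat⟩
      fun x hx => mem_famSupp_ite_one.mp (hK.1 x hx)
  | zeroBool =>
    exact fun K hK hA Δ h => derivable_fam_num ⟨_, .zeroBool⟩
      fun x hx => mem_famSupp_ite_one.mp (hK.1 x hx)
  | oneBool =>
    exact fun K hK hA Δ h => derivable_fam_num ⟨_, .oneBool⟩
      fun x hx => mem_famSupp_ite_one.mp (hK.1 x hx)
  | succ d hd => exact hd.succ
  | pred d hd => exact hd.pred
  | cast d hd => exact hd.cast
  | var x hx => exact .var x hx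
  | lam d hd => exact hd.lam
  | app d e hd he => exact hd.app he
  | ifz d e f hd he hf => exact hd.ifz he hf
  | choice i d e hd he => exact hd.choice i he
  | fix d hd => exact hd.fix

/-- Completeness for rigid monomials. -/
theorem Deriv.exists_refines (d : Deriv Γ M A) {γ : ICtx} {a : ITy} (hA : Adequate Γ A γ a)
    {μ : Mon k} (hμ : μ ∈ supp (d.semAt γ a))
    (h : ∀ s ∈ supp (d.semAt γ a), ∀ s' ∈ supp (d.semAt γ a), s + s' = μ + μ → s = μ) :
    ∃ (s : Poly k) (π : IDeriv M {⟨γ, s, a⟩}), Refines π d ∧ μ ∈ s.support := by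
  classical
  have hr : Rigid (famSupp d.sem) {((γ, a), μ)} := rigid_singleton _ _ hμ h
  have hw : ∀ {Γ : List Ty} {M : Term k} {A : Ty} (d : Deriv Γ M A)
      (h : ∀ (x : ℕ) (A : Ty), Γ[x]? = some A → Γ[x]? = some A), d.weaken h = d := by
    intro Γ M A d
    induction d <;> intros <;> simp_all [Deriv.weaken]
  obtain ⟨π, hπ⟩ := completeFor d _ hr (by simpa using hA) Γ fun _ _ h => h
  rw [hw] at hπ
  have e : fam {((γ, a), μ)} = {(⟨γ, MvPolynomial.monomial μ 1, a⟩ : Entry k)} := by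
    simp [fam, entry]
  revert π
  rw [e]
  exact fun π hπ => ⟨_, π, hπ, by simp [support_monomial_one]⟩

end Complete

/-! ### Soundness -/

section Sound

variable {k : ℕ} {Γ : List Ty} {M N P : Term k} {A B : Ty}

theorem Deriv.sem_weaken (d : Deriv Γ M A) : ∀ {Δ : List Ty}
    (h : ∀ (x : ℕ) (A : Ty), Γ[x]? = some A → Δ[x]? = some A), (d.weaken h).sem = d.sem := by
  induction d <;> intros <;> simp_all [Deriv.weaken, Deriv.sem]

/-- The variables of a term are below a bound. -/
def Term.FreeBelow : Term k → ℕ → Prop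
  | .zero, _ => True
  | .succ M, n => M.FreeBelow n
  | .pred M, n => M.FreeBelow n
  | .ifz M N P, n => M.FreeBelow n ∧ N.FreeBelow n ∧ P.FreeBelow n
  | .var x, n => x < n
  | .lam M, n => M.FreeBelow (n + 1)
  | .app M N, n => M.FreeBelow n ∧ N.FreeBelow n
  | .fix M, n => M.FreeBelow n
  | .choice _ M N, n => M.FreeBelow n ∧ N.FreeBelow n

theorem Deriv.freeBelow (d : Deriv Γ M A) : M.FreeBelow Γ.length := by
  induction d with
  | zeroNat => trivial
  | zeroBool => trivial
  | oneBool => trivial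
  | succ d hd => exact hd
  | pred d hd => exact hd
  | cast d hd => exact hd
  | var x hx => exact (List.getElem?_eq_some_iff.mp hx).1
  | lam d hd => exact hd
  | app d e hd he => exact ⟨hd, he⟩
  | ifz d e f hd he hf => exact ⟨hd, he, hf⟩
  | choice i d e hd he => exact ⟨hd, he⟩
  | fix d hd => exact hd

/-- Addition and minimization of polynomials never create monomials. The first conjunct is separate
because contexts and types must be controlled even without reference to a monomial. -/
theorem exists_of_mem_merge {J : PreJ k} {e : Entry k} (he : e ∈ J.merge) :
    (∃ e' ∈ J, e'.key = e.key) ∧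
      ∀ μ ∈ e.poly.support, ∃ e' ∈ J, e'.key = e.key ∧ μ ∈ e'.poly.support := by
  classical
  obtain ⟨p, hp, rfl⟩ := Multiset.mem_map.mp he
  obtain ⟨e', he', rfl⟩ := Multiset.mem_map.mp (Multiset.mem_toFinset.mp hp)
  refine ⟨⟨e', he', rfl⟩, fun μ hμ => ?_⟩
  have hsupp : ∀ s : Poly k, (polyMin s).support ⊆ s.support := by
    intro s ν hν
    obtain ⟨ξ, hξ, h⟩ := Finset.mem_biUnion.mp (MvPolynomial.support_sum hν)
    rw [support_monomial_one, Finset.mem_singleton] at h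
    exact h ▸ (Finset.mem_filter.mp hξ).1
  have hsum : ∀ s : Multiset (Poly k), μ ∈ s.sum.support → ∃ t ∈ s, μ ∈ t.support := by
    intro s
    induction s using Multiset.induction_on with
    | empty => simp
    | cons a s ih =>
      intro h
      rw [Multiset.sum_cons] at h
      rcases Finset.mem_union.mp (MvPolynomial.support_add h) with h | h
      · exact ⟨a, Multiset.mem_cons_self a s, h⟩
      · obtain ⟨t, ht, h⟩ := ih h
        exact ⟨t, Multiset.mem_cons_of_mem ht, h⟩
  obtain ⟨t, ht, h⟩ := hsum _ (hsupp _ hμ)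
  obtain ⟨e'', he'', rfl⟩ := Multiset.mem_map.mp ht
  obtain ⟨h₁, h₂⟩ := Multiset.mem_filter.mp he''
  exact ⟨e'', h₁, h₂, h⟩

theorem mem_support_polyVN {ι : Type} {F : ι → Poly k} {T : Multiset ι} {μ : Mon k}
    (hμ : μ ∈ (polyVN (T.map F)).support) :
    ∃ K : Multiset (ι × Mon k), K.map Prod.fst = T ∧ (∀ x ∈ K, x.2 ∈ (F x.1).support) ∧
      (K.map Prod.snd).sum = μ := by
  classical
  have hmin : μ ∈ (T.map F).prod.support := by
    obtain ⟨ξ, hξ, h⟩ := Finset.mem_biUnion.mp (MvPolynomial.support_sum hμ)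
    rw [support_monomial_one, Finset.mem_singleton] at h
    exact h ▸ (Finset.mem_filter.mp hξ).1
  refine (mem_multiset_sum_map_iff (fun i => ((F i).support : Set (Mon k))) T μ).mp ?_
  clear hμ
  induction T using Multiset.induction_on generalizing μ with
  | empty =>
    simp only [Multiset.map_zero, Multiset.prod_zero] at hmin
    have := support_monomial_one (0 : Mon k)
    rw [← MvPolynomial.C_apply, MvPolynomial.C_1] at this
    rw [this] at hmin
    simpa using hmin
  | cons a T ih =>
    rw [Multiset.map_cons, Multiset.prod_cons] at hmin
    obtain ⟨u, hu, v, hv, rfl⟩ := Finset.mem_add.mp (MvPolynomial.support_mul _ _ hmin)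
    rw [Multiset.map_cons, Multiset.sum_cons]
    exact Set.add_mem_add hu (ih hv)

/-- All variables in the contexts of a derivation are free in its term. -/
theorem IDeriv.lt_of_ctx_ne_zero {J : PreJ k} (π : IDeriv M J) :
    ∀ n, M.FreeBelow n → ∀ e ∈ J, ∀ (x : ℕ) (a : ITy), e.ctx (x, a) ≠ 0 → x < n := by
  classical
  -- Shared by the application and fixpoint rules, whose conclusions have the same form.
  have happ : ∀ {J J' : PreJ k} {L : Multiset (AppInst k)} (n : ℕ), IsAppFamily J J' L →
      (∀ e ∈ J, ∀ (x : ℕ) (a : ITy), e.ctx (x, a) ≠ 0 → x < n) →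
      (∀ e ∈ J', ∀ (x : ℕ) (a : ITy), e.ctx (x, a) ≠ 0 → x < n) →
      ∀ e ∈ PreJ.merge (L.map AppInst.concl), ∀ (x : ℕ) (a : ITy), e.ctx (x, a) ≠ 0 → x < n := by
    intro J J' L n hL h₁ h₂ e he x a hx
    obtain ⟨e', he', hk⟩ := (exists_of_mem_merge he).1
    obtain ⟨t, ht, rfl⟩ := Multiset.mem_map.mp he'
    obtain ⟨hf, ha⟩ := hL.1 t ht
    rw [← (Prod.mk.inj hk).1] at hx
    by_contra hxn
    apply hx
    have hz : ∀ T : Multiset (Entry k), (∀ e ∈ T, e ∈ J') → (T.map Entry.ctx).sum (x, a) = 0 := by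
      intro T
      induction T using Multiset.induction_on with
      | empty => simp
      | cons b T ih =>
        intro hT
        rw [Multiset.map_cons, Multiset.sum_cons, Finsupp.add_apply,
          ih fun e he => hT e (Multiset.mem_cons_of_mem he), add_zero]
        by_contra h0
        exact hxn (h₂ b (hT b (Multiset.mem_cons_self b T)) x a h0)
    rw [AppInst.concl, Finsupp.add_apply, hz _ ha, add_zero]
    by_contra h0
    exact hxn (h₁ _ hf x a h0)
  induction π with
  | empty M => simp
  | var y I =>
    intro n hn e he x a hx
    obtain ⟨b, -, rfl⟩ := Multiset.mem_map.mp he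
    by_cases h : (y, b) = (x, a)
    · exact (Prod.mk.inj h).1 ▸ hn
    · exact absurd (Finsupp.single_eq_of_ne' h) hx
  | num m h =>
    intro n hn e he x a hx
    rw [Multiset.mem_singleton.mp he] at hx
    exact absurd rfl hx
  | succ L d hd =>
    intro n hn e he x a hx
    obtain ⟨p, hp, rfl⟩ := Multiset.mem_map.mp he
    exact hd n hn _ (Multiset.mem_map_of_mem _ hp) x a hx
  | pred L h d hd =>
    intro n hn e he x a hx
    obtain ⟨p, hp, rfl⟩ := Multiset.mem_map.mp he
    exact hd n hn _ (Multiset.mem_map_of_mem _ hp) x a hx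
  | lam L d hd =>
    intro n hn e he x a hx
    obtain ⟨p, hp, rfl⟩ := Multiset.mem_map.mp he
    exact Nat.lt_of_succ_lt_succ
      (hd (n + 1) hn _ (Multiset.mem_map_of_mem _ hp) (x + 1) a (by simpa using hx))
  | choice i d e hd he =>
    intro n hn t ht x a hx
    obtain ⟨e', he', hk⟩ := (exists_of_mem_merge ht).1
    rw [← (Prod.mk.inj hk).1] at hx
    rcases Multiset.mem_add.mp he' with h | h <;> obtain ⟨u, hu, rfl⟩ := Multiset.mem_map.mp h
    · exact hd n hn.1 u hu x a hx
    · exact he n hn.2 u hu x a hx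
  | ifz L hJ hL d e f hd he hf =>
    intro n hn t ht x a hx
    obtain ⟨e', he', hk⟩ := (exists_of_mem_merge ht).1
    rw [← (Prod.mk.inj hk).1] at hx
    obtain ⟨p, hp, rfl⟩ := Multiset.mem_map.mp he'
    obtain ⟨h₁, h₂⟩ := hL p hp
    rw [ifzConcl, Finsupp.add_apply] at hx
    by_cases h0 : p.1.ctx (x, a) = 0
    · rw [h0, zero_add] at hx
      rcases h₂ with h₂ | h₂
      · exact he n hn.2.1 _ h₂.2 x a hx
      · exact hf n hn.2.2 _ h₂.2 x a hx
    · exact hd n hn.1 _ h₁ x a h0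
  | app L hL d e hd he => exact fun n hn => happ n hL (hd n hn.1) (he n hn.2)
  | fix L hL d e hd he => exact fun n hn => happ n hL (hd n hn) (he n hn)

/-- At the end of the iteration stands the fresh variable, whose support only meets contexts that
mention it. For other contexts it acts as the stage `0`, and every piece of such a context avoids it
too. -/
theorem mem_famSupp_approx_of_unfold (d : Deriv Γ M (.arr A A)) (n : ℕ) :
    ∀ (p : ICtx × ITy) (μ : Mon k), (∀ b, p.1 (Γ.length, b) = 0) →
      μ ∈ famSupp (d.unfold n).sem p → μ ∈ famSupp (FPS.approx A d.sem n) p := by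
  induction n with
  | zero =>
    intro p μ hp hμ
    have := (mem_famSupp_var (a := p.2) (γ := p.1)).mp hμ
    have h0 := hp p.2
    rw [this.1] at h0
    simp [ICtx.single] at h0
  | succ n ih =>
    intro p μ hp hμ
    have : (d.unfold (n + 1)).sem = FPS.app A d.sem (d.unfold n).sem := by
      change FPS.app A (d.weaken (lookup_append [A])).sem _ = _
      rw [Deriv.sem_weaken]
    rw [this, mem_famSupp_app] at hμ
    rw [FPS.approx, mem_famSupp_app]
    obtain ⟨γ₀, ν₀, K, hB, hK, h₀, hγ, hν⟩ := hμ
    refine ⟨γ₀, ν₀, K, hB, fun x hx => ih _ _ (fun b => ?_) (hK x hx), h₀, hγ, hν⟩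
    have hle : x.1.1 ≤ p.1 := by
      rw [← hγ]
      exact (Multiset.le_sum_of_mem (Multiset.mem_map_of_mem (fun y : Pt k => y.1.1) hx)).trans
        le_add_self
    exact Nat.le_zero.mp (hp b ▸ hle _)

/-- Every typing refines `(Γ, A)`, and its monomials are in the support of the family `f`. -/
def SoundFor (Γ : List Ty) (A : Ty) (J : PreJ k) (f : ITy → FPS k) : Prop :=
  ∀ e ∈ J, Adequate Γ A e.ctx e.ty ∧ ∀ μ ∈ e.poly.support, μ ∈ famSupp f (e.ctx, e.ty)

theorem SoundFor.merge {J : PreJ k} {f : ITy → FPS k} (h : SoundFor Γ A J f) :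
    SoundFor Γ A J.merge f := by
  intro e he
  obtain ⟨⟨e', he', hk⟩, hs⟩ := exists_of_mem_merge he
  obtain ⟨h₁, h₂⟩ := Prod.mk.inj hk
  refine ⟨h₁ ▸ h₂ ▸ (h e' he').1, fun μ hμ => ?_⟩
  obtain ⟨e', he', hk, hμ⟩ := hs μ hμ
  have := (h e' he').2 μ hμ
  exact (show (e'.ctx, e'.ty) = (e.ctx, e.ty) from hk) ▸ this

theorem Adequate.add {γ γ' : ICtx} {a b : ITy} (h : Adequate Γ A γ a) (h' : Adequate Γ B γ' b) :
    Adequate Γ B (γ + γ') b := by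
  refine ⟨h'.1, fun x c hc => ?_⟩
  by_cases h0 : γ (x, c) = 0
  · rw [Finsupp.add_apply, h0, zero_add] at hc
    exact h'.2 x c hc
  · exact h.2 x c h0

theorem SoundFor.app {J J' : PreJ k} {f g : ITy → FPS k} {L : Multiset (AppInst k)}
    (h : SoundFor Γ (.arr A B) J f) (h' : SoundFor Γ A J' g) (hL : IsAppFamily J J' L) :
    SoundFor Γ B (PreJ.merge (L.map AppInst.concl)) (FPS.app A f g) := by
  classical
  refine SoundFor.merge fun e he => ?_
  obtain ⟨t, ht, rfl⟩ := Multiset.mem_map.mp he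
  obtain ⟨hf, ha⟩ := hL.1 t ht
  constructor
  · have hfn := (h _ hf).1
    rw [t.eq] at hfn
    obtain ⟨m, b, e, -, hb⟩ := hfn.1
    obtain ⟨-, rfl⟩ := ITy.arr_inj e
    have hz : ∀ T : Multiset (Entry k), (∀ e ∈ T, e ∈ J') →
        Adequate Γ B ((T.map Entry.ctx).sum + t.fn.ctx) t.res := by
      intro T
      induction T using Multiset.induction_on with
      | empty => exact fun _ => by simpa using hfn.anti le_rfl hb
      | cons c T ih =>
        intro hT
        rw [Multiset.map_cons, Multiset.sum_cons, add_assoc]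
        exact (h' c (hT c (Multiset.mem_cons_self c T))).1.add
          (ih fun e he => hT e (Multiset.mem_cons_of_mem he))
    have := hz _ ha
    rwa [add_comm] at this
  · intro μ hμ
    have hμ' : μ ∈ (polyVN ((t.fn ::ₘ t.args).map Entry.poly)).support := by
      rw [Multiset.map_cons]
      exact hμ
    obtain ⟨K, hK, hs, rfl⟩ := mem_support_polyVN hμ'
    have hfn : t.fn ∈ K.map Prod.fst := by rw [hK]; exact Multiset.mem_cons_self _ _
    -- One occurrence of the function's typing is removed from the labelled product; the rest labels
    -- the arguments.
    obtain ⟨x, hx, hxf⟩ := Multiset.mem_map.mp hfn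
    obtain ⟨K', rfl⟩ := Multiset.exists_cons_of_mem hx
    rw [Multiset.map_cons, hxf, Multiset.cons_inj_right] at hK
    have hargs : ∀ y ∈ K', y.1 ∈ J' := fun y hy =>
      ha _ (hK ▸ Multiset.mem_map_of_mem Prod.fst hy)
    have hmap : ∀ {α : Type} (F : Entry k → α), (K'.map fun y => F y.1) = t.args.map F := by
      intro α F
      rw [← hK, Multiset.map_map]
      rfl
    refine mem_famSupp_app.mpr ⟨t.fn.ctx, x.2, K'.map fun y => ((y.1.ctx, y.1.ty), y.2),
      ?_, ?_, ?_, ?_, ?_⟩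
    · intro z hz
      obtain ⟨y, hy, rfl⟩ := Multiset.mem_map.mp hz
      exact (h' _ (hargs y hy)).1.1
    · intro z hz
      obtain ⟨y, hy, rfl⟩ := Multiset.mem_map.mp hz
      exact (h' _ (hargs y hy)).2 _ (hs y (Multiset.mem_cons_of_mem hy))
    · have h₁ := (h _ hf).2 x.2 (hxf ▸ hs x (Multiset.mem_cons_self _ _))
      rw [Multiset.map_map]
      have h₂ := hmap Entry.ty
      rw [t.eq, ← h₂] at h₁
      exact h₁
    · rw [Multiset.map_map]
      exact congrArg (t.fn.ctx + ·) (congrArg Multiset.sum (hmap Entry.ctx))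
    · rw [Multiset.map_map, Multiset.map_cons, Multiset.sum_cons]
      rfl

theorem soundFor_num {f : ITy → FPS k} {n : ℕ} (hn : ITy.nat n ∈ A.den)
    (h : 0 ∈ famSupp f (0, ITy.nat n)) : SoundFor Γ A {⟨0, 1, ITy.nat n⟩} f := by
  intro e he
  rw [Multiset.mem_singleton.mp he]
  refine ⟨⟨hn, fun x b hb => absurd rfl hb⟩, fun μ hμ => ?_⟩
  have := support_monomial_one (0 : Mon k)
  rw [← MvPolynomial.C_apply, MvPolynomial.C_1] at this
  rw [this, Finset.mem_singleton] at hμ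
  exact hμ ▸ h

theorem Refines.sound {J : PreJ k} {π : IDeriv M J} {d : Deriv Γ M A} (h : Refines π d) :
    SoundFor Γ A J d.sem := by
  classical
  induction h with
  | empty d => simp [SoundFor]
  | zeroNat => exact soundFor_num ⟨0, rfl⟩ (mem_famSupp_ite_one.mpr ⟨rfl, rfl, rfl⟩)
  | zeroBool => exact soundFor_num (Or.inl rfl) (mem_famSupp_ite_one.mpr ⟨rfl, rfl, rfl⟩)
  | oneBool => exact soundFor_num (Or.inr rfl) (mem_famSupp_ite_one.mpr ⟨rfl, rfl, rfl⟩)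
  | @var Γ A x h I hI =>
    intro e he
    obtain ⟨b, hb, rfl⟩ := Multiset.mem_map.mp he
    refine ⟨⟨hI b hb, fun y c hc => ?_⟩, fun μ hμ => ?_⟩
    · have : (x, b) = (y, c) := by
        by_contra h
        exact hc (Finsupp.single_eq_of_ne' h)
      obtain ⟨rfl, rfl⟩ := Prod.mk.inj this
      exact ⟨A, h, hI b hb⟩
    · have := support_monomial_one (0 : Mon k)
      rw [← MvPolynomial.C_apply, MvPolynomial.C_1] at this
      rw [this, Finset.mem_singleton] at hμ
      exact mem_famSupp_var.mpr ⟨rfl, hμ⟩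
  | cast _ ih =>
    intro e he
    obtain ⟨h₁, h₂⟩ := ih e he
    refine ⟨h₁.anti le_rfl ?_, fun μ hμ => mem_famSupp_cast.mpr ⟨h₁.1, h₂ μ hμ⟩⟩
    rcases h₁.1 with h | h <;> rw [h]
    · exact ⟨0, rfl⟩
    · exact ⟨1, rfl⟩
  | succ _ ih =>
    intro e he
    obtain ⟨p, hp, rfl⟩ := Multiset.mem_map.mp he
    obtain ⟨h₁, h₂⟩ := ih _ (Multiset.mem_map_of_mem _ hp)
    exact ⟨h₁.anti le_rfl ⟨_, rfl⟩, fun μ hμ => mem_famSupp_succ.mpr ⟨_, rfl, h₂ μ hμ⟩⟩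
  | pred _ ih =>
    intro e he
    obtain ⟨p, hp, rfl⟩ := Multiset.mem_map.mp he
    obtain ⟨h₁, h₂⟩ := ih _ (Multiset.mem_map_of_mem _ hp)
    exact ⟨h₁.anti le_rfl ⟨_, rfl⟩, fun μ hμ => mem_famSupp_pred.mpr ⟨_, rfl, h₂ μ hμ⟩⟩
  | lam _ ih =>
    intro e he
    obtain ⟨p, hp, rfl⟩ := Multiset.mem_map.mp he
    obtain ⟨h₁, h₂⟩ := ih _ (Multiset.mem_map_of_mem _ hp)
    exact ⟨adequate_cons.mp h₁, fun μ hμ => mem_famSupp_lam.mpr ⟨_, _, rfl, h₂ μ hμ⟩⟩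
  | choice i _ _ ih ih' =>
    refine SoundFor.merge fun e he => ?_
    have hX : ∀ (s : Poly k) (V : Par k), ∀ μ ∈ (s * MvPolynomial.X V).support,
        ∃ ν ∈ s.support, ν + Finsupp.single V 1 = μ := by
      intro s V μ hμ
      obtain ⟨u, hu, v, hv, rfl⟩ := Finset.mem_add.mp (MvPolynomial.support_mul _ _ hμ)
      rw [MvPolynomial.X, support_monomial_one, Finset.mem_singleton] at hv
      exact ⟨u, hu, by rw [hv]⟩
    rcases Multiset.mem_add.mp he with h | h <;> obtain ⟨u, hu, rfl⟩ := Multiset.mem_map.mp h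
    · obtain ⟨h₁, h₂⟩ := ih u hu
      refine ⟨h₁, fun μ hμ => ?_⟩
      obtain ⟨ν, hν, rfl⟩ := hX _ _ μ hμ
      exact mem_famSupp_choice.mpr ⟨true, ν, rfl, h₂ ν hν⟩
    · obtain ⟨h₁, h₂⟩ := ih' u hu
      refine ⟨h₁, fun μ hμ => ?_⟩
      obtain ⟨ν, hν, rfl⟩ := hX _ _ μ hμ
      exact mem_famSupp_choice.mpr ⟨false, ν, rfl, h₂ ν hν⟩
  | @ifz Γ M N P A J J₀ J₁ L hJ hL π ρ σ d e f _ _ _ ih ih₀ ih₁ =>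
    refine SoundFor.merge fun e he => ?_
    obtain ⟨p, hp, rfl⟩ := Multiset.mem_map.mp he
    obtain ⟨h₁, h₂⟩ := hL p hp
    obtain ⟨hA, hs⟩ := ih _ h₁
    have hμ : ∀ μ ∈ (ifzConcl p).poly.support, ∃ μ₁ ∈ p.1.poly.support, ∃ μ₂ ∈ p.2.poly.support,
        μ₁ + μ₂ = μ := by
      intro μ hμ
      obtain ⟨ξ, hξ, h⟩ := Finset.mem_biUnion.mp (MvPolynomial.support_sum hμ)
      rw [support_monomial_one, Finset.mem_singleton] at h
      have h' := (Finset.mem_filter.mp hξ).1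
      rw [← h, Multiset.insert_eq_cons, Multiset.prod_cons, Multiset.prod_singleton] at h'
      exact Finset.mem_add.mp (MvPolynomial.support_mul _ _ h')
    rcases h₂ with ⟨h0, h₂⟩ | ⟨⟨n, h0⟩, h₂⟩ <;> rw [h0] at hs
    · obtain ⟨hA', hs'⟩ := ih₀ _ h₂
      refine ⟨hA.add hA', fun μ h => ?_⟩
      obtain ⟨μ₁, hμ₁, μ₂, hμ₂, rfl⟩ := hμ μ h
      exact mem_famSupp_ifz.mpr ⟨_, _, _, _, 0, rfl, rfl, hs _ hμ₁, Or.inl ⟨rfl, hs' _ hμ₂⟩⟩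
    · obtain ⟨hA', hs'⟩ := ih₁ _ h₂
      refine ⟨hA.add hA', fun μ h => ?_⟩
      obtain ⟨μ₁, hμ₁, μ₂, hμ₂, rfl⟩ := hμ μ h
      exact mem_famSupp_ifz.mpr ⟨_, _, _, _, n + 1, rfl, rfl, hs _ hμ₁,
        Or.inr ⟨n.succ_ne_zero, hs' _ hμ₂⟩⟩
  | @app Γ M N A B J J' L hL π ρ d e _ _ ih ih' => exact ih.app ih' hL
  | @fix Γ M A J π d _ ih =>
    intro e he
    obtain ⟨h₁, h₂⟩ := ih e he
    -- Since `π` is a derivation for `Y M` itself, its contexts cannot mention the fresh variable of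
    -- the unfolding. So the extra declaration can be dropped, and the monomials belong to an
    -- approximant.
    have hlt := π.lt_of_ctx_ne_zero _ d.freeBelow e he
    refine ⟨⟨h₁.1, fun x b hb => ?_⟩, fun μ hμ => ?_⟩
    · obtain ⟨B, hB, hb'⟩ := h₁.2 x b hb
      rw [List.getElem?_append_left (hlt x b hb)] at hB
      exact ⟨B, hB, hb'⟩
    · refine mem_famSupp_fix.mpr ⟨_, mem_famSupp_approx_of_unfold d _ _ μ (fun b => ?_) (h₂ μ hμ)⟩
      by_contra h0
      exact lt_irrefl _ (hlt _ _ h0)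

end Sound

/-! ### Vertices and minimal values -/

section Vertices

variable {k : ℕ}

theorem mem_of_mem_newtonVertices {S : Set (Mon k)} {μ : Mon k} (h : μ ∈ newtonVertices S) :
    μ ∈ S := by
  obtain ⟨ν, hν, e⟩ := extremePoints_convexHull_subset h
  have : ν = μ := by
    ext V
    exact Nat.cast_injective (R := ℝ) (congrFun e V)
  exact this ▸ hν

/-- The equation places `μ` in the open segment between `s` and `s'`, and an extreme point admits no
such segment unless its ends coincide with it. -/
theorem eq_of_mem_newtonVertices {S : Set (Mon k)} {μ s s' : Mon k} (h : μ ∈ newtonVertices S)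
    (hs : s ∈ S) (hs' : s' ∈ S) (e : s + s' = μ + μ) : s = μ := by
  have hmem : ∀ ν ∈ S, (fun V => (ν V : ℝ)) ∈
      convexHull ℝ ((fun (ν : Mon k) (V : Par k) => (ν V : ℝ)) '' S) :=
    fun ν hν => subset_convexHull ℝ _ ⟨ν, hν, rfl⟩
  have hseg : (fun V => (μ V : ℝ)) ∈
      openSegment ℝ (fun V => (s V : ℝ)) (fun V => (s' V : ℝ)) := by
    refine ⟨1 / 2, 1 / 2, by norm_num, by norm_num, by norm_num, ?_⟩
    funext V
    have : ((s V : ℝ) + s' V) = μ V + μ V := by exact_mod_cast DFunLike.congr_fun e V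
    simp only [Pi.add_apply, Pi.smul_apply, smul_eq_mul]
    linarith
  have := h.2 (hmem s hs) (hmem s' hs') hseg
  ext V
  exact_mod_cast congrFun this V

theorem pairing_add (μ ν : Mon k) (q : Par k → ℝ≥0∞) :
    pairing (μ + ν) q = pairing μ q + pairing ν q := by
  simp [pairing, add_mul, Finset.sum_add_distrib]

theorem pairing_mono (q : Par k → ℝ≥0∞) : Monotone fun μ : Mon k => pairing μ q := by
  intro μ ν h
  obtain ⟨ξ, rfl⟩ := exists_add_of_le h
  simp only [pairing_add]
  exact le_self_add

theorem nonempty_monomialOrder {σ : Type} [Fintype σ] : Nonempty (MonomialOrder.{0, 0} σ) := by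
  let : LinearOrder σ := LinearOrder.lift' (Fintype.equivFin σ) (Fintype.equivFin σ).injective
  exact ⟨MonomialOrder.lex⟩

/-- In a nonempty set of monomials, the minimum of `μ · q` is attained at a monomial that is not a
proper midpoint. -/
theorem exists_rigid_forall_pairing_le {S : Set (Mon k)} (hS : S.Nonempty) (q : Par k → ℝ≥0∞) :
    ∃ μ ∈ S, (∀ s ∈ S, ∀ s' ∈ S, s + s' = μ + μ → s = μ) ∧
      ∀ ν ∈ S, pairing μ q ≤ pairing ν q := by
  obtain ⟨m⟩ := nonempty_monomialOrder (σ := Par k)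
  obtain ⟨μ₀, hμ₀, hmin⟩ : ∃ μ ∈ S, ∀ ν ∈ S, pairing μ q ≤ pairing ν q := by
    -- Dickson's lemma: monomials are well-quasi-ordered, and so is their image under a monotone
    -- map. Hence the minimum is attained even when `S` is infinite.
    have hwf : ((fun μ : Mon k => pairing μ q) '' S).IsWF :=
      ((Set.isPWO_of_wellQuasiOrderedLE S).image_of_monotone (pairing_mono q)).isWF
    obtain ⟨μ, hμ, e⟩ := hwf.min_mem (hS.image _)
    exact ⟨μ, hμ, fun ν hν => e.trans_le (hwf.min_le (hS.image _) ⟨ν, hν, rfl⟩)⟩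
  -- Several monomials may attain the minimum, and a midpoint of two of them attains it as well; the
  -- least one for a monomial order is chosen.
  obtain ⟨μ, ⟨hμ, hq⟩, hlex⟩ := WellFounded.has_min
    (InvImage.wf m.toSyn (wellFounded_lt : WellFounded ((· < ·) : m.syn → m.syn → Prop)))
    {μ | μ ∈ S ∧ pairing μ q = pairing μ₀ q} ⟨μ₀, hμ₀, rfl⟩
  refine ⟨μ, hμ, fun s hs s' hs' e => ?_, fun ν hν => hq.trans_le (hmin ν hν)⟩
  -- If `μ` is a midpoint, both ends are minimizers: by cancellation when the minimum is finite, and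
  -- because all values are infinite otherwise.
  have hval : ∀ s ∈ S, ∀ s' ∈ S, s + s' = μ + μ → pairing s q = pairing μ₀ q := by
    intro s hs s' hs' e
    have h := congrArg (fun ν => pairing ν q) e
    simp only [pairing_add, hq] at h
    rcases eq_or_ne (pairing μ₀ q) ⊤ with ht | ht
    · exact ht ▸ top_le_iff.mp (ht ▸ hmin s hs)
    · refine le_antisymm ?_ (hmin s hs)
      refine (ENNReal.add_le_add_iff_right ht).mp ?_
      rw [← h]
      gcongr
      exact hmin s' hs'
  have h₁ := not_lt.mp (hlex s ⟨hs, hval s hs s' hs' e⟩)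
  have h₂ := not_lt.mp (hlex s' ⟨hs', hval s' hs' s hs (add_comm s s' ▸ e)⟩)
  have h := congrArg m.toSyn e
  simp only [map_add] at h
  refine m.toSyn.injective (le_antisymm ?_ h₁)
  by_contra hlt
  exact absurd h (add_lt_add_of_lt_of_le (not_le.mp hlt) h₂).ne'

end Vertices

/-- One inequality is soundness. For the other, the infimum is attained at a monomial that is not a
midpoint; that property suffices for completeness, so no vertex is needed. -/
theorem Deriv.tropicalization_eq_sInf {k : ℕ} {M : Term k} (d : Deriv [] M Ty.nat) (n : ℕ)
    (q : Par k → ℝ≥0∞) :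
    tropicalization (d.semAt 0 (ITy.nat n)) q =
      sInf {v : ℝ≥0∞ | ∃ (s : Poly k) (π : IDeriv M {⟨0, s, ITy.nat n⟩}) (μ : Mon k),
        Refines π d ∧ μ ∈ s.support ∧ v = pairing μ q} := by
  refine le_antisymm (le_sInf ?_) (le_iInf₂ fun μ hμ => ?_)
  · rintro v ⟨s, π, μ, hπ, hμ, rfl⟩
    exact iInf₂_le μ ((hπ.sound _ (Multiset.mem_singleton_self _)).2 μ hμ)
  · obtain ⟨ν, hν, hr, hle⟩ := exists_rigid_forall_pairing_le
      (S := supp (d.semAt 0 (ITy.nat n))) ⟨μ, hμ⟩ q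
    obtain ⟨s, π, hπ, hs⟩ := d.exists_refines (γ := 0) (a := ITy.nat n)
      ⟨⟨n, rfl⟩, fun x b hb => absurd rfl hb⟩ hν hr
    refine le_trans (sInf_le ?_) (hle μ hμ)
    exact ⟨s, π, ν, hπ, hs, rfl⟩

end PCFX

end

theorem mainTheorem9 (k : ℕ) :
    (∀ (Γ : List PCFX.Ty) (M : PCFX.Term k) (A : PCFX.Ty) (d : PCFX.Deriv Γ M A)
      (γ : PCFX.ICtx) (a : PCFX.ITy), PCFX.Adequate Γ A γ a →
      ∀ μ ∈ PCFX.minMonomials (PCFX.supp (d.semAt γ a)),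
        ∃ (s : PCFX.Poly k) (π : PCFX.IDeriv M {⟨γ, s, a⟩}),
          PCFX.Refines π d ∧ μ ∈ s.support) ∧
    (∀ (M : PCFX.Term k) (d : PCFX.Deriv [] M PCFX.Ty.nat) (n : ℕ)
      (q : PCFX.Par k → ENNReal),
      PCFX.tropicalization (d.semAt 0 (PCFX.ITy.nat n)) q =
        sInf {v : ENNReal | ∃ (s : PCFX.Poly k)
          (π : PCFX.IDeriv M {⟨0, s, PCFX.ITy.nat n⟩}) (μ : PCFX.Par k →₀ ℕ),
          PCFX.Refines π d ∧ μ ∈ s.support ∧ v = PCFX.pairing μ q}) := by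
  refine ⟨fun Γ M A d γ a hA μ hμ => ?_, fun M d n q => d.tropicalization_eq_sInf n q⟩
  have hv := PCFX.minMonomials_subset _ hμ
  exact d.exists_refines hA (PCFX.mem_of_mem_newtonVertices hv)
    fun s hs s' hs' e => PCFX.eq_of_mem_newtonVertices hv hs hs' e
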